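/- Let $k$ be a field of characteristic $0$, let $n\ge 0$, and let $A=A_n(k)$ be the $n$-th Weyl algebra, i.e. the $k$-algebra generated by $x_1,\dots,x_n,\partial_1,\dots,\partial_n$ with relations $[x_i,x_j]=0$, $[\partial_i,\partial_j]=0$, $[\partial_i,x_j]=\delta_{ij}$. Let $M$ be an $A$-bimodule on which $k$ acts centrally (a $k$-vector space with commuting, $k$-compatible left and right $A$-module structures). Regard $M$ as a left module over $A_{2n}(k)\cong A\otimes_k A^{\mathrm{op}}$ by letting, for $i=1,\dots,n$, $$x_i\cdot m=x_i m,\qquad \partial_i\cdot m=\partial_i m,\qquad x_{n+i}\cdot m=m x_i,\qquad \partial_{n+i}\cdot m=-m\partial_i .$$ Here, for a natural number $N$, the Bernstein filtration of $A_N(k)$ is given by $B_m=\operatorname{Span}_k\{x^\alpha\partial^\beta : |\alpha|+|\beta|\le m\}$. A filtration of a left $A_N(k)$-module $L$ is an increasing sequence $\Gamma_0\subseteq\Gamma_1\subseteq\cdots$ of finite-dimensional subspaces with union $L$ and $B_i\Gamma_j\subseteq\Gamma_{i+j}$; it is good if $\bigoplus_j\Gamma_j/\Gamma_{j-1}$ is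 finitely generated over $\bigoplus_i B_i/B_{i-1}$ (with $\Gamma_{-1}=0$, $B_{-1}=0$). The dimension of a nonzero finitely generated $L$ is the degree of the polynomial that equals $\dim_k\Gamma_j$ for $j\gg0$, for a good filtration $\Gamma$ (it does not depend on the choice of $\Gamma$). A finitely generated left $A_N(k)$-module $L$ is holonomic if $L=0$ or $\dim L=N$. (i) If $M$ is finitely generated as a left $A$-module or as a right $A$-module, then $M$ is holonomic as a left $A_{2n}(k)$-module. (ii) If $M$ is cyclic as a left $A$-module, then $M$ is free as a left $A$-module, and if moreover $M\ne 0$, then $M$ is irreducible as a bimodule. Likewise, if $M$ is cyclic as a right $A$-module, then $M$ is free as a right $A$-module, and if moreover $M\neq0$, then $M$ is irreducible as a bimodule. -/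

import Mathlib

open scoped TensorProduct

/-- The generators `x₁, …, xₙ, ∂₁, …, ∂ₙ` of the `n`-th Weyl algebra. -/
inductive WeylGen (n : ℕ) : Type
  | x (i : Fin n) : WeylGen n
  | d (i : Fin n) : WeylGen n

/-- The relations `[x_i, x_j] = 0`, `[∂_i, ∂_j] = 0`, `[∂_i, x_j] = δ_ij` on the free algebra. -/
inductive WeylRel (k : Type*) [Field k] (n : ℕ) :
    FreeAlgebra k (WeylGen n) → FreeAlgebra k (WeylGen n) → Prop
  | x_x (i j : Fin n) : WeylRel k n
      (FreeAlgebra.ι k (WeylGen.x i) * FreeAlgebra.ι k (WeylGen.x j)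
        - FreeAlgebra.ι k (WeylGen.x j) * FreeAlgebra.ι k (WeylGen.x i)) 0
  | d_d (i j : Fin n) : WeylRel k n
      (FreeAlgebra.ι k (WeylGen.d i) * FreeAlgebra.ι k (WeylGen.d j)
        - FreeAlgebra.ι k (WeylGen.d j) * FreeAlgebra.ι k (WeylGen.d i)) 0
  | d_x (i j : Fin n) : WeylRel k n
      (FreeAlgebra.ι k (WeylGen.d i) * FreeAlgebra.ι k (WeylGen.x j)
        - FreeAlgebra.ι k (WeylGen.x j) * FreeAlgebra.ι k (WeylGen.d i)) (if i = j then 1 else 0)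

/-- The Weyl algebra `A_n(k)`. -/
def WeylAlgebra (k : Type*) [Field k] (n : ℕ) : Type _ :=
  RingQuot (WeylRel k n)

namespace WeylAlgebra

noncomputable section

section Basic

variable (k : Type*) [Field k] (n : ℕ)

instance instRing : Ring (WeylAlgebra k n) := inferInstanceAs (Ring (RingQuot (WeylRel k n)))

instance instAlgebra : Algebra k (WeylAlgebra k n) :=
  inferInstanceAs (Algebra k (RingQuot (WeylRel k n)))

variable {n}

/-- The image of a generator in `A_n(k)`. -/
def gen (g : WeylGen n) : WeylAlgebra k n :=
  RingQuot.mkAlgHom k (WeylRel k n) (FreeAlgebra.ι k g)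

/-- The element `x_i` of `A_n(k)`. -/
def X (i : Fin n) : WeylAlgebra k n := gen k (WeylGen.x i)

/-- The element `∂_i` of `A_n(k)`. -/
def D (i : Fin n) : WeylAlgebra k n := gen k (WeylGen.d i)

theorem X_mul_X (i j : Fin n) : X k i * X k j - X k j * X k i = 0 := by
  have h := RingQuot.mkAlgHom_rel k (WeylRel.x_x (k := k) i j)
  rw [map_sub, map_mul, map_mul, map_zero] at h
  exact h

theorem D_mul_D (i j : Fin n) : D k i * D k j - D k j * D k i = 0 := by
  have h := RingQuot.mkAlgHom_rel k (WeylRel.d_d (k := k) i j)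
  rw [map_sub, map_mul, map_mul, map_zero] at h
  exact h

theorem D_mul_X (i j : Fin n) :
    D k i * X k j - X k j * D k i = if i = j then 1 else 0 := by
  have h := RingQuot.mkAlgHom_rel k (WeylRel.d_x (k := k) i j)
  rw [map_sub, map_mul, map_mul, apply_ite (RingQuot.mkAlgHom k (WeylRel k n)), map_one,
    map_zero] at h
  exact h

variable {k}

/-- The universal property of `A_n(k)`: elements `ξ_i`, `η_i` of a `k`-algebra satisfying the
commutation rules of the `x_i`, `∂_i` define an algebra homomorphism `x_i ↦ ξ_i`, `∂_i ↦ η_i`. -/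
def lift {R : Type*} [Ring R] [Algebra k R] (ξ η : Fin n → R)
    (hξ : ∀ i j, ξ i * ξ j - ξ j * ξ i = 0) (hη : ∀ i j, η i * η j - η j * η i = 0)
    (hηξ : ∀ i j, η i * ξ j - ξ j * η i = if i = j then 1 else 0) :
    WeylAlgebra k n →ₐ[k] R :=
  RingQuot.liftAlgHom k (s := WeylRel k n)
    ⟨FreeAlgebra.lift k (fun g => match g with
      | WeylGen.x i => ξ i
      | WeylGen.d i => η i), by
      intro a b h
      cases h with
      | x_x i j => simpa using hξ i j
      | d_d i j => simpa using hη i j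
      | d_x i j =>
        rw [apply_ite (FreeAlgebra.lift k _), map_one, map_zero]
        simpa using hηξ i j⟩

theorem lift_X {R : Type*} [Ring R] [Algebra k R] (ξ η : Fin n → R) (hξ hη hηξ) (i : Fin n) :
    lift (k := k) ξ η hξ hη hηξ (X k i) = ξ i := by
  unfold lift X gen
  erw [RingQuot.liftAlgHom_mkAlgHom_apply]
  simp

theorem lift_D {R : Type*} [Ring R] [Algebra k R] (ξ η : Fin n → R) (hξ hη hηξ) (i : Fin n) :
    lift (k := k) ξ η hξ hη hηξ (D k i) = η i := by
  unfold lift D gen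
  erw [RingQuot.liftAlgHom_mkAlgHom_apply]
  simp

variable (k)

/-- The monomial `x^α ∂^β = x₁^α₁ ⋯ xₙ^αₙ ∂₁^β₁ ⋯ ∂ₙ^βₙ`. -/
def monomial (α β : Fin n → ℕ) : WeylAlgebra k n :=
  (List.ofFn fun i => X k i ^ α i).prod * (List.ofFn fun i => D k i ^ β i).prod

variable (n)

/-- The Bernstein filtration: `B_m` is the `k`-span of the monomials `x^α ∂^β` of degree at
most `m`. -/
def bernstein (m : ℕ) : Submodule k (WeylAlgebra k n) :=
  Submodule.span k {a | ∃ α β : Fin n → ℕ, (∑ i, α i) + (∑ i, β i) ≤ m ∧ a = monomial k α β}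

end Basic

section Filtration

variable (k : Type*) [Field k] (n : ℕ)
  (M : Type*) [AddCommGroup M] [Module k M] [Module (WeylAlgebra k n) M]
  [IsScalarTower k (WeylAlgebra k n) M]

/-- A filtration of a left `A_n(k)`-module, with respect to the Bernstein filtration. -/
structure Filtration where
  /-- The steps of the filtration. -/
  step : ℕ → Submodule k M
  mono : Monotone step
  finite (i : ℕ) : Module.Finite k (step i)
  iSup_eq_top : ⨆ i, step i = ⊤
  smul_mem {i j : ℕ} {a : WeylAlgebra k n} {m : M} :
    a ∈ bernstein k n i → m ∈ step j → a • m ∈ step (i + j)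

namespace Filtration

variable {k n M}

/-- The previous step `Γ_{j-1}`, where `Γ_{-1} = 0`. -/
def prev (Γ : Filtration k n M) : ℕ → Submodule k M
  | 0 => ⊥
  | j + 1 => Γ.step j

/-- The `j`-th graded piece `Γ_j / Γ_{j-1}`. -/
abbrev GrPiece (Γ : Filtration k n M) (j : ℕ) : Type _ :=
  Γ.step j ⧸ (Γ.prev j).submoduleOf (Γ.step j)

/-- The associated graded space `Gr_Γ(M) = ⨁ Γ_j / Γ_{j-1}`. -/
abbrev Gr (Γ : Filtration k n M) : Type _ := DirectSum ℕ fun j => Γ.GrPiece j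

/-- Multiplication by `a ∈ B_i` as a linear map `Γ_j → Γ_{i+j}`. -/
def mulStep (Γ : Filtration k n M) {i : ℕ} {a : WeylAlgebra k n} (ha : a ∈ bernstein k n i)
    (j : ℕ) : Γ.step j →ₗ[k] Γ.step (i + j) :=
  (Module.toModuleEnd k M a).restrict fun _ hm => Γ.smul_mem ha hm

theorem mulStep_le (Γ : Filtration k n M) {i : ℕ} {a : WeylAlgebra k n}
    (ha : a ∈ bernstein k n i) (j : ℕ) :
    (Γ.prev j).submoduleOf (Γ.step j) ≤
      ((Γ.prev (i + j)).submoduleOf (Γ.step (i + j))).comap (Γ.mulStep ha j) := by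
  intro m hm
  cases j with
  | zero =>
    have h : m = 0 := by
      have h' : (m : M) ∈ (⊥ : Submodule k M) := hm
      exact Subtype.ext ((Submodule.mem_bot k).1 h')
    rw [h]
    exact Submodule.zero_mem _
  | succ j => exact Γ.smul_mem ha (show (m : M) ∈ Γ.step j from hm)

/-- The action on `Gr_Γ(M)` of the class in `B_i / B_{i-1} ⊆ Gr_B(A_n(k))` of `a ∈ B_i`:
it sends the class of `m` in `Γ_j / Γ_{j-1}` to the class of `a m` in `Γ_{i+j} / Γ_{i+j-1}`. -/
def symbolAct (Γ : Filtration k n M) {i : ℕ} {a : WeylAlgebra k n} (ha : a ∈ bernstein k n i) :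
    Γ.Gr →ₗ[k] Γ.Gr :=
  DirectSum.toModule k ℕ Γ.Gr fun j =>
    DirectSum.lof k ℕ Γ.GrPiece (i + j) ∘ₗ Submodule.mapQ _ _ (Γ.mulStep ha j) (Γ.mulStep_le ha j)

/-- A filtration is good if `Gr_Γ(M)` is a finitely generated `Gr_B(A_n(k))`-module. Since
`Gr_B(A_n(k))` is additively generated by the classes of the elements of the `B_i`, its submodules
of `Gr_Γ(M)` are the subspaces stable under all these classes; so the condition is that some
finite set lies in no such subspace other than the whole of `Gr_Γ(M)`. -/
def IsGood (Γ : Filtration k n M) : Prop :=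
  ∃ S : Finset Γ.Gr, ∀ N : Submodule k Γ.Gr,
    (∀ (i : ℕ) (a : WeylAlgebra k n) (ha : a ∈ bernstein k n i), ∀ y ∈ N, Γ.symbolAct ha y ∈ N) →
    (∀ y ∈ S, y ∈ N) → N = ⊤

end Filtration

/-- The left `A_n(k)`-module `M` has dimension `d`: it has a good filtration whose Hilbert
polynomial has degree `d` (this degree does not depend on the good filtration). -/
def HasDimension (d : ℕ) : Prop :=
  ∃ Γ : Filtration k n M, Γ.IsGood ∧ ∃ p : Polynomial ℚ, p.degree = (d : WithBot ℕ) ∧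
    ∀ᶠ i : ℕ in Filter.atTop, (Module.finrank k (Γ.step i) : ℚ) = p.eval (i : ℚ)

/-- A holonomic left `A_n(k)`-module: finitely generated, and zero or nonzero of dimension `n`. -/
def IsHolonomic : Prop :=
  Module.Finite (WeylAlgebra k n) M ∧
    (Subsingleton M ∨ (Nontrivial M ∧ HasDimension k n M n))

end Filtration

section Bimodule

variable (k : Type*) [Field k] (n : ℕ)

/-- The map `A_{2n}(k) → A_n(k) ⊗ A_n(k)ᵒᵖ` (an isomorphism) given by `x_i ↦ x_i ⊗ 1`,
`∂_i ↦ ∂_i ⊗ 1`, `x_{n+i} ↦ 1 ⊗ x_i`, `∂_{n+i} ↦ 1 ⊗ (-∂_i)` for `i = 1, …, n`. -/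
def toEnveloping :
    WeylAlgebra k (n + n) →ₐ[k] WeylAlgebra k n ⊗[k] (WeylAlgebra k n)ᵐᵒᵖ :=
  lift
    (Fin.addCases (fun i => X k i ⊗ₜ[k] 1) (fun i => 1 ⊗ₜ[k] MulOpposite.op (X k i)))
    (Fin.addCases (fun i => D k i ⊗ₜ[k] 1) (fun i => 1 ⊗ₜ[k] MulOpposite.op (-D k i)))
    (by
      intro i j
      induction i using Fin.addCases <;> induction j using Fin.addCases <;>
        simp [-Fin.natAdd_eq_addNat, Algebra.TensorProduct.tmul_mul_tmul, ← TensorProduct.sub_tmul,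
          ← TensorProduct.tmul_sub, ← MulOpposite.op_mul, ← MulOpposite.op_sub, X_mul_X])
    (by
      intro i j
      induction i using Fin.addCases <;> induction j using Fin.addCases <;>
        simp [-Fin.natAdd_eq_addNat, -MulOpposite.op_neg, Algebra.TensorProduct.tmul_mul_tmul, ← TensorProduct.sub_tmul,
          ← TensorProduct.tmul_sub, ← MulOpposite.op_mul, ← MulOpposite.op_sub, D_mul_D])
    (by
      intro i j
      induction i using Fin.addCases with
      | left i =>
        induction j using Fin.addCases with
        | left j =>
          simp only [Fin.addCases_left, Algebra.TensorProduct.tmul_mul_tmul, mul_one,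
            ← TensorProduct.sub_tmul, D_mul_X, Fin.castAdd_inj]
          split_ifs
          · rfl
          · exact TensorProduct.zero_tmul _ _
        | right j =>
          have h : Fin.castAdd n i ≠ Fin.natAdd n j := by
            intro h
            have := congrArg Fin.val h
            simp at this
            omega
          simp [-Fin.natAdd_eq_addNat, h]
      | right i =>
        induction j using Fin.addCases with
        | left j =>
          have h : Fin.natAdd n i ≠ Fin.castAdd n j := by
            intro h
            have := congrArg Fin.val h
            simp at this
            omega
          simp [-Fin.natAdd_eq_addNat, h]
        | right j =>
          have h : X k j * (-D k i) - (-D k i) * X k j = if i = j then 1 else 0 := by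
            rw [← D_mul_X k i j]
            noncomm_ring
          simp only [Fin.addCases_right, Algebra.TensorProduct.tmul_mul_tmul, mul_one,
            ← TensorProduct.tmul_sub, ← MulOpposite.op_mul, ← MulOpposite.op_sub, h,
            Fin.natAdd_inj]
          split_ifs
          · rfl
          · exact TensorProduct.tmul_zero _ _)

variable (M : Type*) [AddCommGroup M] [Module k M]
  [Module (WeylAlgebra k n) M] [IsScalarTower k (WeylAlgebra k n) M]
  [Module (WeylAlgebra k n)ᵐᵒᵖ M] [IsScalarTower k (WeylAlgebra k n)ᵐᵒᵖ M]
  [SMulCommClass (WeylAlgebra k n) (WeylAlgebra k n)ᵐᵒᵖ M]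

/-- An `A_n(k)`-bimodule as a left module over `A_n(k) ⊗ A_n(k)ᵒᵖ`: `(a ⊗ b) m = a m b`. -/
abbrev envelopingModule : Module (WeylAlgebra k n ⊗[k] (WeylAlgebra k n)ᵐᵒᵖ) M :=
  TensorProduct.Algebra.module

/-- An `A_n(k)`-bimodule as a left module over `A_{2n}(k)`. -/
abbrev doubleModule : Module (WeylAlgebra k (n + n)) M :=
  letI := envelopingModule k n M
  Module.compHom M (toEnveloping k n).toRingHom

theorem doubleModule_isScalarTower :
    letI := doubleModule k n M
    IsScalarTower k (WeylAlgebra k (n + n)) M := by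
  let := envelopingModule k n M
  let := doubleModule k n M
  refine ⟨fun c a m => ?_⟩
  change toEnveloping k n (c • a) • m = c • (toEnveloping k n a • m)
  rw [map_smul]
  induction toEnveloping k n a using TensorProduct.induction_on with
  | zero =>
    have h := zero_smul (WeylAlgebra k n ⊗[k] (WeylAlgebra k n)ᵐᵒᵖ) m
    rw [smul_zero, h, smul_zero]
  | tmul a b =>
    rw [TensorProduct.smul_tmul', TensorProduct.Algebra.smul_def, TensorProduct.Algebra.smul_def,
      smul_assoc]
  | add a b ha hb => rw [smul_add, add_smul, add_smul, smul_add, ha, hb]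

/-- A bimodule over `A_n(k)` is holonomic if it is so as a left `A_{2n}(k)`-module. -/
def IsHolonomicBimodule : Prop :=
  letI := doubleModule k n M
  haveI := doubleModule_isScalarTower k n M
  IsHolonomic k (n + n) M

/-- A bimodule over `A_n(k)` is irreducible if it is nonzero and has no sub-bimodules other
than zero and itself. -/
def IsIrreducibleBimodule : Prop :=
  letI := envelopingModule k n M
  IsSimpleModule (WeylAlgebra k n ⊗[k] (WeylAlgebra k n)ᵐᵒᵖ) M

end Bimodule

end

end WeylAlgebra

/-!
Bimodules over the Weyl algebra `A = A_n(k)`, regarded as left modules over `A_{2n}(k)`: those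
finitely generated on one side are holonomic, and those cyclic on one side are free on that side
and, if nonzero, irreducible.

A module over `A_N(k)` generated by `e₁, …, e_s` carries the good filtration
`Γ_j = B_j e₁ + ⋯ + B_j e_s` (`stdFiltration_isGood`). Its Hilbert function is computed as for
Gröbner bases. Order the vectors `x^α ∂^β e_t` by degree, then lexicographically; those that are not
linear combinations of smaller ones form a basis adapted to the filtration. Multiplication by a
generator raises an exponent up to terms of smaller degree, so the exponents of the remaining,
reducible, vectors form an up-closed set (`isUpperSet_reducible`). By Dickson's lemma the complement
of an up-closed set of exponents has an eventually polynomial counting function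
(`eventuallyPoly_card_compl`), hence so has `Γ`. No basis theorem for `A_N(k)` is needed.

Bernstein's inequality (`le_of_finrank_step_le`) says that a nonzero module does not grow more
slowly than `j^N`: the monomials of degree at most `i` are linearly independent as maps
`Γ_i → Γ_{2i}`, since commutators with the generators differentiate monomials and the characteristic
is `0`. So a module whose filtration is bounded by a multiple of `j^N` has dimension exactly `N`.

Let now `M` be generated by finitely many elements as a left `A`-module, say. The right
multiplications commute with the left action and move the generators of `M` by a bounded number `w`
of filtration steps, so the filtration of `M` over `A_{2n}(k)` satisfies `Γ_j ⊆ Γ'_{wj}`, with `Γ'`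
that over `A` (`ExtendsAction.exists_stepSpan_le`). As `dim Γ'_j` is at most a multiple of `j^{2n}`,
`M` is holonomic. If `M = A m` and `a m = 0` with `a ≠ 0`, then the exponent of the leading monomial
of `a` and all larger ones are reducible, so `dim Γ'_j` is at most a multiple of `j^{2n-1}`, and
Bernstein's inequality over `A_{2n}(k)` gives `M = 0`
(`ExtendsAction.eq_zero_of_smul_eq_zero`). Thus `M` is free; and a quotient of `M` by a nonzero
sub-bimodule is cyclic with a relation, so it is zero. The right-hand versions follow from the same
statements, since a right `A`-module is a left one through the transposition `x_i ↦ x_i`,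
`∂_i ↦ -∂_i`.
-/

namespace WeylAlgebra

/-! ### Counting the complement of an up-closed set of exponents -/

/-- The exponents `μ ∈ ℕ^r` of degree `μ₁ + ⋯ + μ_r ≤ j`. -/
def lowDegree (r j : ℕ) : Finset (Fin r → ℕ) :=
  (Fintype.piFinset fun _ => Finset.range (j + 1)).filter fun μ => ∑ i, μ i ≤ j

theorem mem_lowDegree {r j : ℕ} {μ : Fin r → ℕ} : μ ∈ lowDegree r j ↔ ∑ i, μ i ≤ j := by
  simp only [lowDegree, Finset.mem_filter, Fintype.mem_piFinset, Finset.mem_range,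
    and_iff_right_iff_imp]
  intro h i
  have := Finset.single_le_sum (f := μ) (fun _ _ => Nat.zero_le _) (Finset.mem_univ i)
  omega

/-- A function `ℕ → ℕ` that agrees with a rational polynomial at all large arguments. -/
def EventuallyPoly (f : ℕ → ℕ) : Prop :=
  ∃ p : Polynomial ℚ, ∀ᶠ j : ℕ in Filter.atTop, (f j : ℚ) = p.eval (j : ℚ)

theorem EventuallyPoly.sum {ι : Type*} (s : Finset ι) {f : ι → ℕ → ℕ}
    (h : ∀ i ∈ s, EventuallyPoly (f i)) : EventuallyPoly fun j => ∑ i ∈ s, f i j := by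
  classical
  choose! p hp using h
  refine ⟨∑ i ∈ s, p i, ?_⟩
  filter_upwards [(Filter.eventually_all_finset s).2 hp] with j hj
  rw [Nat.cast_sum, Polynomial.eval_finsetSum]
  exact Finset.sum_congr rfl hj

theorem EventuallyPoly.add {f g : ℕ → ℕ} (hf : EventuallyPoly f) (hg : EventuallyPoly g) :
    EventuallyPoly fun j => f j + g j := by
  obtain ⟨p, hp⟩ := hf
  obtain ⟨q, hq⟩ := hg
  refine ⟨p + q, ?_⟩
  filter_upwards [hp, hq] with j h₁ h₂
  rw [Nat.cast_add, Polynomial.eval_add, h₁, h₂]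

theorem EventuallyPoly.congr {f g : ℕ → ℕ} (hf : EventuallyPoly f)
    (h : ∀ᶠ j in Filter.atTop, g j = f j) : EventuallyPoly g := by
  obtain ⟨p, hp⟩ := hf
  refine ⟨p, ?_⟩
  filter_upwards [hp, h] with j h₁ h₂
  rw [h₂, h₁]

theorem EventuallyPoly.shift {f : ℕ → ℕ} (hf : EventuallyPoly f) (c : ℕ) :
    EventuallyPoly fun j => f (j - c) := by
  obtain ⟨p, hp⟩ := hf
  refine ⟨p.comp (Polynomial.X - Polynomial.C (c : ℚ)), ?_⟩
  filter_upwards [(Filter.tendsto_sub_atTop_nat c).eventually hp, Filter.eventually_ge_atTop c]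
    with j h₁ h₂
  simp [h₁, Nat.cast_sub h₂]

theorem exists_sum_range_eval (p : Polynomial ℚ) :
    ∃ q : Polynomial ℚ, ∀ m : ℕ, ∑ i ∈ Finset.range m, p.eval (i : ℚ) = q.eval (m : ℚ) := by
  induction p using Polynomial.induction_on' with
  | add p₁ p₂ h₁ h₂ =>
    obtain ⟨q₁, h₁⟩ := h₁
    obtain ⟨q₂, h₂⟩ := h₂
    exact ⟨q₁ + q₂, fun m => by simp [Finset.sum_add_distrib, h₁, h₂]⟩
  | monomial d a =>
    refine ⟨Polynomial.C a * ∑ i ∈ Finset.range (d + 1), Polynomial.C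
      (bernoulli i * ((d + 1).choose i : ℚ) / (d + 1)) * Polynomial.X ^ (d + 1 - i), fun m => ?_⟩
    simp only [Polynomial.eval_monomial, Polynomial.eval_mul, Polynomial.eval_C,
      Polynomial.eval_finsetSum, Polynomial.eval_pow, Polynomial.eval_X]
    rw [← Finset.mul_sum, sum_range_pow]
    congr 1
    refine Finset.sum_congr rfl fun i _ => ?_
    ring

theorem EventuallyPoly.sum_range {f : ℕ → ℕ} (hf : EventuallyPoly f) :
    EventuallyPoly fun j => ∑ i ∈ Finset.range j, f i := by
  obtain ⟨p, hp⟩ := hf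
  obtain ⟨j₀, hj₀⟩ := Filter.eventually_atTop.1 hp
  obtain ⟨q, hq⟩ := exists_sum_range_eval p
  refine ⟨q + Polynomial.C ((∑ i ∈ Finset.range j₀, (f i : ℚ)) - q.eval (j₀ : ℚ)), ?_⟩
  filter_upwards [Filter.eventually_ge_atTop j₀] with j hj
  rw [Polynomial.eval_add, Polynomial.eval_C, ← hq, ← hq, Nat.cast_sum,
    ← Finset.sum_range_add_sum_Ico _ hj, ← Finset.sum_range_add_sum_Ico (fun i : ℕ => p.eval _) hj]
  have h : ∑ i ∈ Finset.Ico j₀ j, (f i : ℚ) = ∑ i ∈ Finset.Ico j₀ j, p.eval (i : ℚ) :=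
    Finset.sum_congr rfl fun i hi => hj₀ i (Finset.mem_Ico.1 hi).1
  rw [h]
  ring

open Classical in
/-- Slicing `ℕ^(r+1)` along the first coordinate. -/
theorem card_lowDegree_succ (r j : ℕ) (U : Set (Fin (r + 1) → ℕ)) :
    ((lowDegree (r + 1) j).filter (· ∉ U)).card =
      ∑ c ∈ Finset.range (j + 1),
        ((lowDegree r (j - c)).filter fun ν => Fin.cons c ν ∉ U).card := by
  rw [Finset.card_eq_sum_card_fiberwise (f := fun μ => μ 0) (t := Finset.range (j + 1))]
  · refine Finset.sum_congr rfl fun c hc => ?_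
    have hc' : c < j + 1 := Finset.mem_range.1 hc
    refine Finset.card_nbij' Fin.tail (fun ν => Fin.cons c ν) ?_ ?_ ?_ ?_
    · intro μ hμ
      simp only [Finset.coe_filter, Finset.mem_filter, mem_lowDegree, Set.mem_ofPred_eq,
        Fin.sum_univ_succ] at hμ ⊢
      obtain ⟨⟨h₁, h₂⟩, rfl⟩ := hμ
      refine ⟨?_, by rwa [Fin.cons_self_tail]⟩
      simp only [Fin.tail]
      omega
    · intro ν hν
      simp only [Finset.coe_filter, Finset.mem_filter, mem_lowDegree, Set.mem_ofPred_eq,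
        Fin.sum_univ_succ, Fin.cons_zero, Fin.cons_succ] at hν ⊢
      exact ⟨⟨by omega, hν.2⟩, trivial⟩
    · intro μ hμ
      simp only [Finset.coe_filter, Set.mem_ofPred_eq] at hμ
      change Fin.cons c (Fin.tail μ) = μ
      rw [← hμ.2, Fin.cons_self_tail]
    · intro ν _
      exact Fin.tail_cons _ _
  · intro μ hμ
    have h := (Finset.mem_filter.1 hμ).1
    rw [mem_lowDegree, Fin.sum_univ_succ] at h
    simp only [Finset.coe_range, Set.mem_Iio]
    omega

/-- By Dickson's lemma, the slices of an up-closed subset of `ℕ^(r+1)` stabilise. -/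
theorem exists_slice_stable (r : ℕ) {U : Set (Fin (r + 1) → ℕ)} (hU : IsUpperSet U) :
    ∃ c₀ : ℕ, ∀ c, c₀ ≤ c → ∀ ν : Fin r → ℕ,
      (Fin.cons c ν : Fin (r + 1) → ℕ) ∈ U ↔ (Fin.cons c₀ ν : Fin (r + 1) → ℕ) ∈ U := by
  have hfin : {μ | Minimal (· ∈ U) μ}.Finite :=
    WellQuasiOrderedLE.finite_of_isAntichain (setOfPred_minimal_antichain _)
  obtain ⟨c₀, hc₀⟩ := (hfin.image fun μ => μ 0).bddAbove
  refine ⟨c₀, fun c hc ν => ⟨fun h => ?_, fun h => hU ?_ h⟩⟩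
  · obtain ⟨μ, hμν, hμ⟩ := exists_minimal_le_of_wellFoundedLT (· ∈ U) _ h
    refine hU (fun i => ?_) hμ.prop
    refine Fin.cases ?_ (fun i => ?_) i
    · exact hc₀ ⟨μ, hμ, rfl⟩
    · exact hμν i.succ
  · exact Fin.cons_le_cons.2 ⟨hc, le_rfl⟩

open Classical in
/-- The Hilbert function of the complement of an up-closed subset of `ℕ^r` is eventually
polynomial. -/
theorem eventuallyPoly_card_compl (r : ℕ) {U : Set (Fin r → ℕ)} (hU : IsUpperSet U) :
    EventuallyPoly fun j => ((lowDegree r j).filter (· ∉ U)).card := by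
  induction r with
  | zero =>
    refine ⟨Polynomial.C (((lowDegree 0 0).filter (· ∉ U)).card : ℚ), .of_forall fun j => ?_⟩
    have h : lowDegree 0 j = lowDegree 0 0 := by
      ext μ
      simp [mem_lowDegree]
    simp only [h, Polynomial.eval_C]
  | succ r ih =>
    obtain ⟨c₀, hc₀⟩ := exists_slice_stable r hU
    let F : ℕ → ℕ → ℕ := fun c j => ((lowDegree r j).filter fun ν => Fin.cons c ν ∉ U).card
    have hF : ∀ c, EventuallyPoly (F c) := by
      intro c
      have hUc : IsUpperSet {ν : Fin r → ℕ | (Fin.cons c ν : Fin (r + 1) → ℕ) ∈ U} := by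
        intro a b hab ha
        exact hU (Fin.cons_le_cons.2 ⟨le_rfl, hab⟩) ha
      exact ih hUc
    have hF₀ : ∀ c, c₀ ≤ c → F c = F c₀ := by
      intro c hc
      funext j
      simp only [F, hc₀ c hc]
    have h₁ : EventuallyPoly fun j => ∑ c ∈ Finset.range c₀, F c (j - c) :=
      EventuallyPoly.sum _ fun c _ => (hF c).shift c
    have h₂ : EventuallyPoly fun j => (∑ i ∈ Finset.range (j - c₀), F c₀ i) + F c₀ (j - c₀) :=
      ((hF c₀).sum_range.shift c₀).add ((hF c₀).shift c₀)
    refine (h₁.add h₂).congr ?_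
    filter_upwards [Filter.eventually_ge_atTop c₀] with j hj
    rw [card_lowDegree_succ, ← Finset.sum_range_succ,
      ← Finset.sum_range_add_sum_Ico _ (by omega : c₀ ≤ j + 1)]
    congr 1
    rw [Finset.sum_Ico_eq_sum_range, ← Finset.sum_range_reflect (F c₀)]
    refine Finset.sum_congr (by congr 1; omega) fun i hi => ?_
    have hi' := Finset.mem_range.1 hi
    change F (c₀ + i) (j - (c₀ + i)) = _
    rw [hF₀ _ (by omega)]
    congr 1
    omega

theorem card_lowDegree_le (r j : ℕ) : (lowDegree r j).card ≤ (j + 1) ^ r :=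
  (Finset.card_filter_le _ _).trans (by simp)

theorem le_card_lowDegree (r q : ℕ) : (q + 1) ^ r ≤ (lowDegree r (r * q)).card := by
  have h : (Fintype.piFinset fun _ : Fin r => Finset.range (q + 1)) ⊆ lowDegree r (r * q) := by
    intro μ hμ
    rw [Fintype.mem_piFinset] at hμ
    rw [mem_lowDegree]
    calc ∑ i, μ i ≤ ∑ _i : Fin r, q :=
          Finset.sum_le_sum fun i _ => Nat.lt_succ_iff.1 (Finset.mem_range.1 (hμ i))
      _ = r * q := by simp
  simpa using Finset.card_le_card h

open Classical in
/-- The exponents not above a fixed one lie in finitely many hyperplanes, so their number grows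
more slowly than that of all exponents. -/
theorem card_lowDegree_not_ge (r j : ℕ) (μ₀ : Fin r → ℕ) :
    ((lowDegree r j).filter fun μ => ¬ μ₀ ≤ μ).card ≤ (∑ i, μ₀ i) * (j + 1) ^ (r - 1) := by
  have h : ((lowDegree r j).filter fun μ => ¬ μ₀ ≤ μ) ⊆ Finset.univ.biUnion fun i =>
      Fintype.piFinset (Function.update (fun _ => Finset.range (j + 1)) i
        (Finset.range (μ₀ i))) := by
    intro μ hμ
    obtain ⟨h₁, h₂⟩ := Finset.mem_filter.1 hμ
    obtain ⟨i, hi⟩ := not_forall.1 h₂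
    refine Finset.mem_biUnion.2 ⟨i, Finset.mem_univ i, Fintype.mem_piFinset.2 fun l => ?_⟩
    by_cases hl : l = i
    · subst hl
      simpa using hi
    · rw [Function.update_of_ne hl]
      exact Fintype.mem_piFinset.1 (Finset.mem_filter.1 h₁).1 l
  refine (Finset.card_le_card h).trans (Finset.card_biUnion_le.trans ?_)
  rw [Finset.sum_mul]
  refine Finset.sum_le_sum fun i _ => ?_
  rw [Fintype.card_piFinset, ← Finset.mul_prod_erase _ _ (Finset.mem_univ i),
    Function.update_self, Finset.card_range]
  refine Nat.mul_le_mul_left _ (le_of_eq ?_)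
  rw [Finset.prod_congr rfl fun l hl => by
    rw [Function.update_of_ne (Finset.ne_of_mem_erase hl), Finset.card_range]]
  simp [Finset.card_erase_of_mem]

/-! ### Commutation rules for monomials -/

theorem mul_prod_ofFn_pow {R : Type*} [Ring R] {n : ℕ} (f : Fin n → R)
    (hf : ∀ i j, f i * f j = f j * f i) (j : Fin n) (α : Fin n → ℕ) :
    f j * (List.ofFn fun i => f i ^ α i).prod =
      (List.ofFn fun i => f i ^ (α + Pi.single j 1 : Fin n → ℕ) i).prod := by
  induction n with
  | zero => exact j.elim0
  | succ n ih =>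
    simp only [List.ofFn_succ, List.prod_cons]
    induction j using Fin.cases with
    | zero => simp [← mul_assoc, ← pow_succ']
    | succ j =>
      have h₁ : f j.succ * f 0 ^ α 0 = f 0 ^ α 0 * f j.succ :=
        (Commute.pow_right (show Commute (f j.succ) (f 0) from hf _ _) _).eq
      have h₂ := ih (fun i => f i.succ) (fun i l => hf _ _) j (fun i => α i.succ)
      rw [← mul_assoc, h₁, mul_assoc, h₂]
      simp [Pi.single_apply, Fin.succ_inj]

/-- If `[d, f_j] = z` is an integer and `d` commutes with the other `f_i`, then the commutator with
`d` acts on monomials in the `f_i` as `z` times differentiation with respect to `f_j`. -/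
theorem commutator_prod_ofFn_pow {R : Type*} [Ring R] {n : ℕ} (f : Fin n → R)
    (hf : ∀ i j, f i * f j = f j * f i) (d : R) (j : Fin n) (z : ℤ)
    (hd : ∀ i, d * f i - f i * d = if j = i then (z : R) else 0) (α : Fin n → ℕ) :
    d * (List.ofFn fun i => f i ^ α i).prod - (List.ofFn fun i => f i ^ α i).prod * d =
      (z * α j) • (List.ofFn fun i => f i ^ (α - Pi.single j 1 : Fin n → ℕ) i).prod := by
  induction hs : ∑ i, α i generalizing α with
  | zero =>
    have hα : α = 0 := by
      funext i
      exact (Finset.sum_eq_zero_iff.1 hs) i (Finset.mem_univ i)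
    simp [hα]
  | succ s ih =>
    obtain ⟨i, hi⟩ : ∃ i, α i ≠ 0 := by
      by_contra! h
      simp [h] at hs
    obtain ⟨α', rfl⟩ : ∃ α' : Fin n → ℕ, α = α' + Pi.single i 1 := by
      refine ⟨α - Pi.single i 1, ?_⟩
      funext l
      rcases eq_or_ne l i with rfl | hl
      · simp
        omega
      · simp [hl]
    have h := ih α' (by simp [Finset.sum_add_distrib] at hs; omega)
    rw [← mul_prod_ofFn_pow f hf]
    set P := (List.ofFn fun i => f i ^ α' i).prod with hP
    have key : d * (f i * P) - f i * P * d = (d * f i - f i * d) * P + f i * (d * P - P * d) := by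
      noncomm_ring
    rw [key, h, hd, mul_smul_comm, mul_prod_ofFn_pow f hf]
    rcases eq_or_ne j i with rfl | hji
    · rcases Nat.eq_zero_or_pos (α' j) with h0 | hpos
      · have : α' + Pi.single j 1 - Pi.single j 1 = α' := by
          funext l; simp
        rw [this]
        simp [h0, ← hP]
      · have e₁ : α' - Pi.single j 1 + Pi.single j 1 = α' := by
          funext l
          rcases eq_or_ne l j with rfl | hl
          · simp
            omega
          · simp [hl]
        have e₂ : α' + Pi.single j 1 - Pi.single j 1 = α' := by
          funext l; simp
        rw [e₁, e₂, ← hP, if_pos rfl]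
        have e₃ : (α' + Pi.single j 1 : Fin n → ℕ) j = α' j + 1 := by simp
        rw [e₃]
        push_cast
        rw [mul_add, mul_one, add_smul, add_comm, zsmul_eq_mul P z]
    · have e : α' - Pi.single j 1 + Pi.single i 1 = α' + Pi.single i 1 - Pi.single j 1 := by
        funext l
        rcases eq_or_ne l j with rfl | hl
        · simp [hji]
        · simp [hl]
      rw [e, if_neg hji, zero_mul, zero_add, Pi.add_apply, Pi.single_eq_of_ne hji, add_zero]

section Monomials

variable (k : Type*) [Field k] {n : ℕ}

/-- The `2n` generators of `A_n(k)`, in the order `x₁, …, xₙ, ∂₁, …, ∂ₙ`. -/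
noncomputable def gens (q : Fin (n + n)) : WeylAlgebra k n := Fin.addCases (X k) (D k) q

/-- The monomial `x^α ∂^β` with joint exponent `μ = (α, β)`. -/
noncomputable def mon (μ : Fin (n + n) → ℕ) : WeylAlgebra k n :=
  monomial k (fun i => μ (Fin.castAdd n i)) (fun i => μ (Fin.natAdd n i))

/-- The exchange `x_i ↔ ∂_i` of indices. -/
def conj (q : Fin (n + n)) : Fin (n + n) := Fin.addCases (Fin.natAdd n) (Fin.castAdd n) q

theorem gens_castAdd (i : Fin n) : gens k (Fin.castAdd n i) = X k i := Fin.addCases_left i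

theorem gens_natAdd (i : Fin n) : gens k (Fin.natAdd n i) = D k i := Fin.addCases_right i

theorem conj_castAdd (i : Fin n) : conj (Fin.castAdd n i) = Fin.natAdd n i := Fin.addCases_left i

theorem conj_natAdd (i : Fin n) : conj (Fin.natAdd n i) = Fin.castAdd n i := Fin.addCases_right i

theorem castAdd_ne_natAdd (i j : Fin n) : Fin.castAdd n i ≠ Fin.natAdd n j := by
  intro h
  have := congrArg Fin.val h
  simp at this
  omega

theorem monomial_zero : monomial k (0 : Fin n → ℕ) 0 = 1 := by
  simp [monomial]

theorem mon_zero : mon k (0 : Fin (n + n) → ℕ) = 1 := monomial_zero k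

theorem X_mul_monomial (i : Fin n) (α β : Fin n → ℕ) :
    X k i * monomial k α β = monomial k (α + Pi.single i 1) β := by
  rw [monomial, ← mul_assoc,
    mul_prod_ofFn_pow (X k) fun i j => sub_eq_zero.1 (X_mul_X k i j), monomial]

theorem D_commutator_monomial (i : Fin n) (α β : Fin n → ℕ) :
    D k i * monomial k α β - monomial k α β * D k i =
      (α i : ℤ) • monomial k (α - Pi.single i 1) β := by
  have hD : ∀ i j : Fin n, D k i * D k j = D k j * D k i := fun i j => sub_eq_zero.1 (D_mul_D k i j)
  have h₁ := commutator_prod_ofFn_pow (X k) (fun i j => sub_eq_zero.1 (X_mul_X k i j)) (D k i) i 1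
    (by simpa using D_mul_X k i) α
  have h₂ := commutator_prod_ofFn_pow (D k) hD (D k i) i 0
    (by simpa using D_mul_D k i) β
  simp only [one_mul, zero_mul, zero_smul] at h₁ h₂
  rw [monomial, monomial, ← smul_mul_assoc, ← h₁]
  rw [sub_eq_zero] at h₂
  rw [mul_assoc _ _ (D k i), ← h₂]
  noncomm_ring

theorem X_commutator_monomial (i : Fin n) (α β : Fin n → ℕ) :
    X k i * monomial k α β - monomial k α β * X k i =
      (-(β i : ℤ)) • monomial k α (β - Pi.single i 1) := by
  have hX : ∀ i j : Fin n, X k i * X k j = X k j * X k i := fun i j => sub_eq_zero.1 (X_mul_X k i j)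
  have h₁ := commutator_prod_ofFn_pow (D k) (fun i j => sub_eq_zero.1 (D_mul_D k i j)) (X k i) i
    (-1) (fun j => by
      rw [← neg_sub, D_mul_X]
      by_cases h : j = i
      · simp [h]
      · simp [h, Ne.symm h]) β
  have h₂ := commutator_prod_ofFn_pow (X k) hX (X k i) i 0 (by simpa using X_mul_X k i) α
  simp only [neg_mul, one_mul, zero_mul, zero_smul] at h₁ h₂
  rw [monomial, monomial, ← mul_smul_comm, ← h₁]
  rw [sub_eq_zero] at h₂
  rw [← mul_assoc, h₂]
  noncomm_ring

theorem D_mul_monomial (i : Fin n) (α β : Fin n → ℕ) :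
    D k i * monomial k α β =
      monomial k α (β + Pi.single i 1) + (α i : ℤ) • monomial k (α - Pi.single i 1) β := by
  have h₁ := commutator_prod_ofFn_pow (X k) (fun i j => sub_eq_zero.1 (X_mul_X k i j)) (D k i) i 1
    (by simpa using D_mul_X k i) α
  rw [one_mul] at h₁
  rw [monomial, monomial, monomial,
    ← mul_prod_ofFn_pow (D k) fun i j => sub_eq_zero.1 (D_mul_D k i j), ← smul_mul_assoc, ← h₁]
  noncomm_ring

theorem comp_castAdd_add_single (μ : Fin (n + n) → ℕ) (i : Fin n) :
    (fun l => (μ + Pi.single (Fin.castAdd n i) 1 : Fin (n + n) → ℕ) (Fin.castAdd n l)) =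
      (fun l => μ (Fin.castAdd n l)) + Pi.single i 1 := by
  funext l
  simp [Pi.single_apply, Fin.castAdd_inj]

theorem comp_natAdd_add_single (μ : Fin (n + n) → ℕ) (i : Fin n) :
    (fun l => (μ + Pi.single (Fin.natAdd n i) 1 : Fin (n + n) → ℕ) (Fin.natAdd n l)) =
      (fun l => μ (Fin.natAdd n l)) + Pi.single i 1 := by
  funext l
  simp [Pi.single_apply, -Fin.natAdd_eq_addNat]

theorem comp_castAdd_add_single_natAdd (μ : Fin (n + n) → ℕ) (i : Fin n) :
    (fun l => (μ + Pi.single (Fin.natAdd n i) 1 : Fin (n + n) → ℕ) (Fin.castAdd n l)) =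
      fun l => μ (Fin.castAdd n l) := by
  funext l
  rw [Pi.add_apply, Pi.single_eq_of_ne (castAdd_ne_natAdd _ _), add_zero]

theorem comp_natAdd_add_single_castAdd (μ : Fin (n + n) → ℕ) (i : Fin n) :
    (fun l => (μ + Pi.single (Fin.castAdd n i) 1 : Fin (n + n) → ℕ) (Fin.natAdd n l)) =
      fun l => μ (Fin.natAdd n l) := by
  funext l
  rw [Pi.add_apply, Pi.single_eq_of_ne (castAdd_ne_natAdd _ _).symm, add_zero]

/-- Up to sign, the commutator with the conjugate of the `q`-th generator is differentiation of
monomials with respect to the `q`-th generator. -/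
theorem exists_commutator_mon (q : Fin (n + n)) : ∃ ε : ℤ, ε ≠ 0 ∧
    (∀ μ : Fin (n + n) → ℕ, gens k (conj q) * mon k (μ + Pi.single q 1) -
      mon k (μ + Pi.single q 1) * gens k (conj q) = (ε * (μ q + 1)) • mon k μ) ∧
    ∀ μ : Fin (n + n) → ℕ, μ q = 0 → gens k (conj q) * mon k μ = mon k μ * gens k (conj q) := by
  induction q using Fin.addCases with
  | left i =>
    refine ⟨1, one_ne_zero, fun μ => ?_, fun μ hμ => ?_⟩
    · rw [conj_castAdd, gens_natAdd, mon, mon, comp_castAdd_add_single,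
        comp_natAdd_add_single_castAdd, D_commutator_monomial, add_tsub_cancel_right]
      simp
    · rw [← sub_eq_zero, conj_castAdd, gens_natAdd, mon, D_commutator_monomial, hμ]
      simp
  | right i =>
    refine ⟨-1, by simp, fun μ => ?_, fun μ hμ => ?_⟩
    · rw [conj_natAdd, gens_castAdd, mon, mon, comp_natAdd_add_single,
        comp_castAdd_add_single_natAdd, X_commutator_monomial, add_tsub_cancel_right]
      simp
    · rw [← sub_eq_zero, conj_natAdd, gens_castAdd, mon, X_commutator_monomial, hμ]
      simp

theorem sum_add_single {r : ℕ} (μ : Fin r → ℕ) (q : Fin r) :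
    ∑ l, (μ + Pi.single q 1 : Fin r → ℕ) l = (∑ l, μ l) + 1 := by
  simp [Finset.sum_add_distrib]

theorem exists_add_single {r : ℕ} {μ : Fin r → ℕ} {q : Fin r} (h : μ q ≠ 0) :
    ∃ ν : Fin r → ℕ, μ = ν + Pi.single q 1 := by
  refine ⟨μ - Pi.single q 1, ?_⟩
  funext l
  rcases eq_or_ne l q with rfl | hl
  · simp
    omega
  · simp [hl]

/-- Multiplication by a generator raises exponents, up to a multiple of a monomial of smaller
degree. -/
theorem exists_gens_mul_mon (q : Fin (n + n)) (μ : Fin (n + n) → ℕ) :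
    ∃ (z : ℤ) (ν : Fin (n + n) → ℕ), ∑ l, ν l ≤ ∑ l, μ l ∧
      gens k q * mon k μ = mon k (μ + Pi.single q 1) + z • mon k ν := by
  induction q using Fin.addCases with
  | left i =>
    refine ⟨0, μ, le_rfl, ?_⟩
    rw [gens_castAdd, mon, mon, X_mul_monomial, comp_castAdd_add_single,
      comp_natAdd_add_single_castAdd, zero_smul, add_zero]
  | right i =>
    by_cases h : μ (Fin.castAdd n i) = 0
    · refine ⟨0, μ, le_rfl, ?_⟩
      rw [gens_natAdd, mon, mon, D_mul_monomial, comp_natAdd_add_single,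
        comp_castAdd_add_single_natAdd, h]
      simp
    · obtain ⟨ν, rfl⟩ := exists_add_single h
      refine ⟨((ν + Pi.single (Fin.castAdd n i) 1 : Fin (n + n) → ℕ) (Fin.castAdd n i) : ℤ),
        ν, ?_, ?_⟩
      rotate_left
      · rw [gens_natAdd, mon, mon, D_mul_monomial, comp_natAdd_add_single,
          comp_castAdd_add_single_natAdd, comp_natAdd_add_single_castAdd, comp_castAdd_add_single,
          add_tsub_cancel_right]
        rfl
      · rw [sum_add_single]
        omega

/-- The first generator occurring in a monomial can be split off without any commutation. -/
theorem exists_mon_eq_gens_mul {μ : Fin (n + n) → ℕ} {q : Fin (n + n)} (h : μ q ≠ 0)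
    (hq : ∀ l, l < q → μ l = 0) : ∃ ν : Fin (n + n) → ℕ,
      ∑ l, μ l = (∑ l, ν l) + 1 ∧ mon k μ = gens k q * mon k ν := by
  obtain ⟨ν, rfl⟩ := exists_add_single h
  refine ⟨ν, sum_add_single _ _, ?_⟩
  induction q using Fin.addCases with
  | left i =>
    rw [gens_castAdd, mon, mon, X_mul_monomial, comp_castAdd_add_single,
      comp_natAdd_add_single_castAdd]
  | right i =>
    have h0 := hq (Fin.castAdd n i) (by
      have := i.isLt
      rw [Fin.lt_def, Fin.val_castAdd, Fin.val_natAdd]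
      omega)
    rw [Pi.add_apply, Pi.single_eq_of_ne (castAdd_ne_natAdd _ _), add_zero] at h0
    rw [gens_natAdd, mon, mon, D_mul_monomial, comp_natAdd_add_single,
      comp_castAdd_add_single_natAdd, h0]
    simp

/-- Every monomial of positive degree is a generator times a monomial of smaller degree. -/
theorem exists_gens_mul_of_ne_zero {μ : Fin (n + n) → ℕ} (h : μ ≠ 0) :
    ∃ (q : Fin (n + n)) (ν : Fin (n + n) → ℕ),
      ∑ l, μ l = (∑ l, ν l) + 1 ∧ mon k μ = gens k q * mon k ν := by
  obtain ⟨q, hq, hmin⟩ := exists_minimal_of_wellFoundedLT (fun q => μ q ≠ 0)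
    (Function.ne_iff.1 h)
  refine ⟨q, exists_mon_eq_gens_mul k hq fun l hl => ?_⟩
  by_contra hne
  exact absurd (hmin hne hl.le) (not_le.2 hl)

theorem monomial_eq_mon (α β : Fin n → ℕ) : monomial k α β = mon k (Fin.append α β) := by
  simp [mon, -Fin.natAdd_eq_addNat]

theorem mon_mem_bernstein {μ : Fin (n + n) → ℕ} {j : ℕ} (h : ∑ l, μ l ≤ j) :
    mon k μ ∈ bernstein k n j :=
  Submodule.subset_span ⟨_, _, by rwa [Fin.sum_univ_add] at h, rfl⟩

theorem bernstein_le_iff {j : ℕ} {S : Submodule k (WeylAlgebra k n)} :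
    bernstein k n j ≤ S ↔ ∀ μ : Fin (n + n) → ℕ, ∑ l, μ l ≤ j → mon k μ ∈ S := by
  refine ⟨fun h μ hμ => h (mon_mem_bernstein k hμ), fun h => Submodule.span_le.2 ?_⟩
  rintro _ ⟨α, β, hαβ, rfl⟩
  rw [monomial_eq_mon]
  exact h _ (by simpa [Fin.sum_univ_add, -Fin.natAdd_eq_addNat] using hαβ)

/-- Since the generators generate `A_n(k)`, a subspace stable under them is stable under
`A_n(k)`. -/
theorem mul_mem_of_gens_mul_mem {R : Type*} [Ring R] [Algebra k R] (f : WeylAlgebra k n →ₐ[k] R)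
    {L : Type*} [AddCommGroup L] [Module k L] [Module R L] [IsScalarTower k R L]
    (S : Submodule k L) (h : ∀ q, ∀ y ∈ S, f (gens k q) • y ∈ S) (a : WeylAlgebra k n) :
    ∀ y ∈ S, f a • y ∈ S := by
  obtain ⟨π, hπ, hx, hd⟩ : ∃ π : FreeAlgebra k (WeylGen n) →ₐ[k] WeylAlgebra k n,
      Function.Surjective π ∧ (∀ i, π (FreeAlgebra.ι k (WeylGen.x i)) = X k i) ∧
        ∀ i, π (FreeAlgebra.ι k (WeylGen.d i)) = D k i :=
    ⟨RingQuot.mkAlgHom k (WeylRel k n), RingQuot.mkAlgHom_surjective k (WeylRel k n),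
      fun _ => rfl, fun _ => rfl⟩
  obtain ⟨a, rfl⟩ := hπ a
  induction a using FreeAlgebra.induction with
  | grade0 r =>
    intro y hy
    rw [AlgHom.commutes, AlgHom.commutes, algebraMap_smul]
    exact S.smul_mem r hy
  | grade1 g =>
    cases g with
    | x i => rw [hx, ← gens_castAdd]; exact h _
    | d i => rw [hd, ← gens_natAdd]; exact h _
  | mul a b ha hb =>
    intro y hy
    rw [map_mul, map_mul, mul_smul]
    exact ha _ (hb y hy)
  | add a b ha hb =>
    intro y hy
    rw [map_add, map_add, add_smul]
    exact S.add_mem (ha y hy) (hb y hy)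

theorem span_mon : Submodule.span k (Set.range (mon k (n := n))) = ⊤ := by
  refine eq_top_iff.2 fun a _ => ?_
  have h := mul_mem_of_gens_mul_mem k (AlgHom.id k (WeylAlgebra k n))
    (Submodule.span k (Set.range (mon k (n := n)))) (fun q y hy => ?_) a 1
    (Submodule.subset_span ⟨0, mon_zero k⟩)
  · simpa using h
  · induction hy using Submodule.span_induction with
    | mem y hy =>
      obtain ⟨μ, rfl⟩ := hy
      obtain ⟨z, ν, -, hν⟩ := exists_gens_mul_mon k q μ
      rw [AlgHom.id_apply, smul_eq_mul, hν]
      exact add_mem (Submodule.subset_span (Set.mem_range_self _))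
        (zsmul_mem (Submodule.subset_span (Set.mem_range_self _)) z)
    | zero => simp
    | add y z _ _ hy hz => rw [smul_add]; exact add_mem hy hz
    | smul c y _ hy => rw [smul_comm]; exact Submodule.smul_mem _ c hy

end Monomials

/-! ### The filtration generated by finitely many elements -/

section StepSpan

variable (k : Type*) [Field k] {n : ℕ} {L : Type*} [AddCommGroup L] [Module k L]
  [Module (WeylAlgebra k n) L] [IsScalarTower k (WeylAlgebra k n) L] {s : ℕ} (e : Fin s → L)

/-- The vector `x^α ∂^β e_t` attached to an exponent `μ = (α, β)` and an index `t`. -/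
noncomputable def vec (p : (Fin (n + n) → ℕ) × Fin s) : L := mon k p.1 • e p.2

/-- The pairs of an exponent of degree at most `j` and an index. -/
def lowPairs (r s j : ℕ) : Finset ((Fin r → ℕ) × Fin s) := lowDegree r j ×ˢ Finset.univ

theorem mem_lowPairs {r j : ℕ} {p : (Fin r → ℕ) × Fin s} :
    p ∈ lowPairs r s j ↔ ∑ l, p.1 l ≤ j := by
  simp [lowPairs, mem_lowDegree]

/-- The subspace `B_j e₁ + ⋯ + B_j e_s` of `L`. -/
noncomputable def stepSpan (j : ℕ) : Submodule k L :=
  Submodule.span k (vec (n := n) k e '' (lowPairs (n + n) s j : Set _))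

variable {e}

omit [IsScalarTower k (WeylAlgebra k n) L] in
theorem vec_mem_stepSpan {j : ℕ} {p : (Fin (n + n) → ℕ) × Fin s} (h : ∑ l, p.1 l ≤ j) :
    vec k e p ∈ stepSpan (n := n) k e j :=
  Submodule.subset_span ⟨p, Finset.mem_coe.2 (mem_lowPairs.2 h), rfl⟩

omit [IsScalarTower k (WeylAlgebra k n) L] in
theorem stepSpan_le_iff {j : ℕ} {S : Submodule k L} :
    stepSpan (n := n) k e j ≤ S ↔
      ∀ p : (Fin (n + n) → ℕ) × Fin s, ∑ l, p.1 l ≤ j → vec k e p ∈ S := by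
  refine ⟨fun h p hp => h (vec_mem_stepSpan k hp), fun h => Submodule.span_le.2 ?_⟩
  rintro _ ⟨p, hp, rfl⟩
  exact h p (mem_lowPairs.1 (Finset.mem_coe.1 hp))

omit [IsScalarTower k (WeylAlgebra k n) L] in
variable (e) in
theorem stepSpan_mono : Monotone (stepSpan (n := n) k e) := fun _ _ hij =>
  (stepSpan_le_iff k).2 fun _ hp => vec_mem_stepSpan k (hp.trans hij)

instance stepSpan_finite (j : ℕ) : Module.Finite k (stepSpan (n := n) k e j) :=
  FiniteDimensional.span_of_finite k ((Finset.finite_toSet _).image _)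

/-- The `k`-linear action of an element of `A_n(k)`. -/
noncomputable abbrev act (a : WeylAlgebra k n) : L →ₗ[k] L := Module.toModuleEnd k L a

omit [Module k L] [IsScalarTower k (WeylAlgebra k n) L] in
variable (e) in
theorem exists_gens_smul_vec (q : Fin (n + n)) (p : (Fin (n + n) → ℕ) × Fin s) :
    ∃ (z : ℤ) (ν : Fin (n + n) → ℕ), ∑ l, ν l ≤ ∑ l, p.1 l ∧
      gens k q • vec k e p = vec k e (p.1 + Pi.single q 1, p.2) + z • vec k e (ν, p.2) := by
  obtain ⟨z, ν, h, hν⟩ := exists_gens_mul_mon k q p.1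
  refine ⟨z, ν, h, ?_⟩
  rw [vec, smul_smul, hν, add_smul, smul_assoc]
  rfl

theorem gens_smul_mem_stepSpan (q : Fin (n + n)) {j : ℕ} {y : L}
    (hy : y ∈ stepSpan (n := n) k e j) : gens k q • y ∈ stepSpan (n := n) k e (j + 1) := by
  suffices h : stepSpan (n := n) k e j ≤
      (stepSpan (n := n) k e (j + 1)).comap (act k (gens k q) : L →ₗ[k] L) from h hy
  refine (stepSpan_le_iff k).2 fun p hp => ?_
  obtain ⟨z, ν, hν, h⟩ := exists_gens_smul_vec k e q p
  change gens k q • vec k e p ∈ stepSpan k e (j + 1)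
  rw [h]
  refine add_mem (vec_mem_stepSpan k ?_) (zsmul_mem (vec_mem_stepSpan k ?_) z)
  · rw [sum_add_single]
    omega
  · change ∑ l, ν l ≤ _
    omega

omit [IsScalarTower k (WeylAlgebra k n) L] in
/-- If generators raise an increasing family of subspaces by `w`, monomials of degree at most `i`
raise it by `w i`. -/
theorem mon_smul_mem_of_gens (F : ℕ → Submodule k L) (hF : Monotone F) (w : ℕ)
    (h : ∀ q : Fin (n + n), ∀ j, ∀ y ∈ F j, gens k q • y ∈ F (w + j)) (i : ℕ)
    (μ : Fin (n + n) → ℕ) (hμ : ∑ l, μ l ≤ i) {j : ℕ} {y : L} (hy : y ∈ F j) :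
    mon k μ • y ∈ F (w * i + j) := by
  induction i generalizing μ with
  | zero =>
    have : μ = 0 := by
      funext l
      exact Finset.sum_eq_zero_iff.1 (Nat.le_zero.1 hμ) l (Finset.mem_univ l)
    rw [this, mon_zero, one_smul]
    simpa using hy
  | succ i ih =>
    by_cases h0 : μ = 0
    · rw [h0, mon_zero, one_smul]
      exact hF (Nat.le_add_left _ _) hy
    · obtain ⟨q, ν, hν, hq⟩ := exists_gens_mul_of_ne_zero k h0
      rw [hq, mul_smul]
      have := h q _ _ (ih ν (by omega))
      rwa [show w + (w * i + j) = w * (i + 1) + j by ring] at this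

theorem bernstein_smul_mem {i j : ℕ} {a : WeylAlgebra k n} {y : L} (ha : a ∈ bernstein k n i)
    (hy : y ∈ stepSpan (n := n) k e j) : a • y ∈ stepSpan (n := n) k e (i + j) := by
  suffices h : bernstein k n i ≤ (stepSpan (n := n) k e (i + j)).comap
      ((LinearMap.toSpanSingleton (WeylAlgebra k n) L y).restrictScalars k) from h ha
  refine (bernstein_le_iff k).2 fun μ hμ => ?_
  have := mon_smul_mem_of_gens k _ (stepSpan_mono (n := n) k e) 1 (fun q j y hy => by
    rw [add_comm]; exact gens_smul_mem_stepSpan k q hy) i μ hμ hy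
  rw [one_mul] at this
  exact this

omit [IsScalarTower k (WeylAlgebra k n) L] in
theorem e_mem_stepSpan (t : Fin s) : e t ∈ stepSpan (n := n) k e 0 := by
  have := vec_mem_stepSpan (n := n) k (e := e) (j := 0) (p := (0, t)) (by simp)
  rwa [vec, mon_zero, one_smul] at this

theorem iSup_stepSpan (he : Submodule.span (WeylAlgebra k n) (Set.range e) = ⊤) :
    ⨆ j, stepSpan (n := n) k e j = ⊤ := by
  refine eq_top_iff.2 fun y _ => ?_
  have hmem : ∀ y, y ∈ ⨆ j, stepSpan (n := n) k e j ↔ ∃ j, y ∈ stepSpan (n := n) k e j := fun y =>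
    Submodule.mem_iSup_of_directed _ (stepSpan_mono k e).directed_le
  have hy : y ∈ Submodule.span (WeylAlgebra k n) (Set.range e) := he ▸ Submodule.mem_top
  induction hy using Submodule.span_induction with
  | mem y hy =>
    obtain ⟨t, rfl⟩ := hy
    exact (hmem _).2 ⟨0, e_mem_stepSpan k t⟩
  | zero => exact zero_mem _
  | add y z _ _ hy hz => exact add_mem (hy trivial) (hz trivial)
  | smul a y _ hy =>
    refine mul_mem_of_gens_mul_mem k (AlgHom.id k (WeylAlgebra k n)) _ (fun q y hy => ?_) a y
      (hy trivial)
    obtain ⟨j, hj⟩ := (hmem y).1 hy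
    exact (hmem _).2 ⟨j + 1, gens_smul_mem_stepSpan k q hj⟩

/-- The filtration `Γ_j = B_j e₁ + ⋯ + B_j e_s` of a module generated by `e₁, …, e_s`. -/
noncomputable def stdFiltration
    (he : Submodule.span (WeylAlgebra k n) (Set.range e) = ⊤) : Filtration k n L where
  step := stepSpan (n := n) k e
  mono := stepSpan_mono k e
  finite := fun _ => inferInstance
  iSup_eq_top := iSup_stepSpan k he
  smul_mem := fun ha hy => bernstein_smul_mem k ha hy

/-- The associated graded module is generated by the classes of the `e_t` in degree `0`. -/
theorem stdFiltration_isGood (he : Submodule.span (WeylAlgebra k n) (Set.range e) = ⊤) :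
    (stdFiltration k he).IsGood := by
  classical
  set Γ := stdFiltration k he
  let g : Fin s → Γ.Gr := fun t =>
    DirectSum.lof k ℕ Γ.GrPiece 0 (Submodule.Quotient.mk ⟨e t, e_mem_stepSpan k t⟩)
  refine ⟨Finset.univ.image g, fun N hN hS => ?_⟩
  have hg : ∀ t, g t ∈ N := fun t => hS _ (Finset.mem_image_of_mem g (Finset.mem_univ t))
  have key : ∀ j (y : Γ.step j),
      DirectSum.lof k ℕ Γ.GrPiece j (Submodule.Quotient.mk y) ∈ N := by
    intro j
    suffices h : stepSpan (n := n) k e j ≤ (N.comap (DirectSum.lof k ℕ Γ.GrPiece j ∘ₗ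
        ((Γ.prev j).submoduleOf (Γ.step j)).mkQ)).map (Γ.step j).subtype by
      intro y
      obtain ⟨y', hy', hyy⟩ := h y.2
      rw [← Subtype.ext (a1 := y') (a2 := y) hyy]
      exact hy'
    refine (stepSpan_le_iff k).2 fun p hp => ?_
    refine ⟨⟨vec k e p, vec_mem_stepSpan k hp⟩, ?_, rfl⟩
    -- A vector of degree below `j` has class zero in `Γ_j / Γ_{j-1}`; one of degree `j` is the image
    -- of the class of `e_t` under the symbol of a monomial.
    rcases hp.lt_or_eq with hlt | heq
    · change DirectSum.lof k ℕ Γ.GrPiece j (Submodule.Quotient.mk _) ∈ N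
      have h0 : (Submodule.Quotient.mk ⟨vec k e p, vec_mem_stepSpan k hp⟩ : Γ.GrPiece j) = 0 := by
        rw [Submodule.Quotient.mk_eq_zero]
        cases j with
        | zero => omega
        | succ j => exact vec_mem_stepSpan k (Nat.lt_succ_iff.1 hlt)
      rw [h0, map_zero]
      exact zero_mem N
    · have h := hN j (mon k p.1) (mon_mem_bernstein k hp) (g p.2) (hg p.2)
      have h' : Γ.symbolAct (mon_mem_bernstein k hp) (g p.2) = DirectSum.lof k ℕ Γ.GrPiece j
          (Submodule.Quotient.mk ⟨vec k e p, vec_mem_stepSpan k hp⟩) := by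
        simp only [g, Filtration.symbolAct, DirectSum.toModule_lof, LinearMap.comp_apply]
        rfl
      rw [h'] at h
      exact h
  refine eq_top_iff.2 fun y _ => ?_
  induction y using DirectSum.induction_on with
  | zero => exact zero_mem N
  | of j y =>
    obtain ⟨y, rfl⟩ := Submodule.Quotient.mk_surjective _ y
    exact key j y
  | add y z hy hz => exact add_mem (hy trivial) (hz trivial)

end StepSpan

/-! ### Reducible monomials and the Hilbert function -/

open Classical in
/-- Gaussian elimination: the dimension of the span of a finite ordered family is the number of
its members outside the span of the preceding ones. -/
theorem finrank_span_image_eq_card {k L ι K : Type*} [Field k] [AddCommGroup L] [Module k L]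
    [LinearOrder K] (key : ι → K) (hkey : Function.Injective key) (v : ι → L) (s : Finset ι) :
    Module.finrank k (Submodule.span k (v '' (s : Set ι))) =
      (s.filter fun i => v i ∉ Submodule.span k (v '' {l | l ∈ s ∧ key l < key i})).card := by
  induction s using Finset.induction_on_max_value key with
  | empty =>
    rw [Finset.coe_empty, Set.image_empty, Submodule.span_empty, finrank_bot,
      Finset.filter_empty, Finset.card_empty]
  | insert a s ha hmax ih =>
    have hlt : ∀ x ∈ s, key x < key a := fun x hx =>
      (hmax x hx).lt_of_ne fun h => ha (hkey h ▸ hx)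
    have h₁ : {l | l ∈ insert a s ∧ key l < key a} = (s : Set ι) := by
      ext l
      simp only [Finset.mem_insert, Set.mem_ofPred_eq, Finset.mem_coe]
      refine ⟨?_, fun h => ⟨Or.inr h, hlt l h⟩⟩
      rintro ⟨rfl | h, h'⟩
      · exact absurd h' (lt_irrefl _)
      · exact h
    have h₂ : ∀ i ∈ s, {l | l ∈ insert a s ∧ key l < key i} = {l | l ∈ s ∧ key l < key i} := by
      intro i hi
      ext l
      simp only [Finset.mem_insert, Set.mem_ofPred_eq]
      refine ⟨?_, fun h => ⟨Or.inr h.1, h.2⟩⟩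
      rintro ⟨rfl | h, h'⟩
      · exact absurd h' (hlt i hi).not_gt
      · exact ⟨h, h'⟩
    have hfd : Module.Finite k (Submodule.span k (v '' (s : Set ι))) :=
      FiniteDimensional.span_of_finite k ((Finset.finite_toSet _).image _)
    have h₃ : (s.filter fun i => v i ∉ Submodule.span k
        (v '' {l | l ∈ insert a s ∧ key l < key i})) =
        s.filter fun i => v i ∉ Submodule.span k (v '' {l | l ∈ s ∧ key l < key i}) :=
      Finset.filter_congr fun i hi => by rw [h₂ i hi]
    rw [Finset.filter_insert, h₁, h₃, Finset.coe_insert, Set.image_insert_eq]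
    by_cases hva : v a ∈ Submodule.span k (v '' (s : Set ι))
    · rw [if_neg (not_not.2 hva), Submodule.span_insert_eq_span hva, ih]
    · rw [if_pos hva, Finset.card_insert_of_notMem fun h => ha (Finset.mem_filter.1 h).1, ← ih,
        Submodule.span_insert, sup_comm]
      have h := Submodule.finrank_sup_add_finrank_inf_eq (Submodule.span k (v '' (s : Set ι)))
        (Submodule.span k {v a})
      have h0 : v a ≠ 0 := fun h0 => hva (h0 ▸ zero_mem _)
      rwa [finrank_span_singleton h0, ((Submodule.disjoint_span_singleton' h0).2 hva).eq_bot,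
        finrank_bot, add_zero] at h

/-- The order on pairs `(μ, t)`: by degree, then lexicographically in `μ`, then by `t`. -/
def pairKey {r s : ℕ} (p : (Fin r → ℕ) × Fin s) : ℕ ×ₗ (Lex (Fin r → ℕ) ×ₗ Fin s) :=
  toLex (∑ l, p.1 l, toLex (toLex p.1, p.2))

theorem pairKey_injective {r s : ℕ} : Function.Injective (pairKey (r := r) (s := s)) := by
  intro p p' h
  have h₁ := (Prod.mk.inj (toLex.injective h)).2
  have h₂ := Prod.mk.inj (toLex.injective h₁)
  exact Prod.ext (toLex.injective h₂.1) h₂.2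

theorem pairKey_lt_of_degree_lt {r s : ℕ} {p p' : (Fin r → ℕ) × Fin s}
    (h : ∑ l, p.1 l < ∑ l, p'.1 l) : pairKey p < pairKey p' :=
  Prod.Lex.toLex_lt_toLex.2 (Or.inl h)

theorem degree_le_of_pairKey_lt {r s : ℕ} {p p' : (Fin r → ℕ) × Fin s}
    (h : pairKey p < pairKey p') : ∑ l, p.1 l ≤ ∑ l, p'.1 l := by
  rcases Prod.Lex.toLex_lt_toLex.1 h with h | h
  · exact h.le
  · exact h.1.le

theorem pairKey_add_single_lt {r s : ℕ} {p p' : (Fin r → ℕ) × Fin s} (q : Fin r)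
    (h : pairKey p < pairKey p') :
    pairKey (p.1 + Pi.single q 1, p.2) < pairKey (p'.1 + Pi.single q 1, p'.2) := by
  refine Prod.Lex.toLex_lt_toLex.2 ?_
  simp only [sum_add_single]
  rcases Prod.Lex.toLex_lt_toLex.1 h with h | ⟨h, h'⟩
  · exact Or.inl (Nat.succ_lt_succ h)
  · refine Or.inr ⟨congrArg Nat.succ h, Prod.Lex.toLex_lt_toLex.2 ?_⟩
    rcases Prod.Lex.toLex_lt_toLex.1 h' with h' | ⟨h', h''⟩
    · exact Or.inl (add_lt_add_left h' (toLex (Pi.single q 1)))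
    · exact Or.inr ⟨congrArg (fun μ => toLex (ofLex μ + Pi.single q 1)) h', h''⟩

theorem isUpperSet_of_add_single {r : ℕ} {U : Set (Fin r → ℕ)}
    (h : ∀ μ ∈ U, ∀ q, μ + Pi.single q 1 ∈ U) : IsUpperSet U := by
  intro μ μ' hle hμ
  induction hd : ∑ l, (μ' - μ) l generalizing μ' with
  | zero =>
    have : μ' = μ := by
      funext l
      have h₁ := Finset.sum_eq_zero_iff.1 hd l (Finset.mem_univ l)
      have h₂ : μ l ≤ μ' l := hle l
      simp only [Pi.sub_apply] at h₁
      omega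
    rwa [this]
  | succ d ih =>
    obtain ⟨q, hq⟩ : ∃ q, μ' q - μ q ≠ 0 := by
      by_contra! h
      simp [h] at hd
    obtain ⟨ν, rfl⟩ := exists_add_single (μ := μ') (q := q) (by omega)
    have hle' : μ ≤ ν := by
      intro l
      rcases eq_or_ne l q with rfl | hl
      · rw [Pi.add_apply, Pi.single_eq_same] at hq
        exact Nat.lt_succ_iff.1 (Nat.sub_ne_zero_iff_lt.1 hq)
      · have h₂ : μ l ≤ (ν + Pi.single q 1 : Fin r → ℕ) l := hle l
        rwa [Pi.add_apply, Pi.single_eq_of_ne hl, add_zero] at h₂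
    refine h ν (ih hle' ?_) q
    rw [← tsub_add_eq_add_tsub hle', sum_add_single] at hd
    exact Nat.succ.inj hd

section Reducible

variable (k : Type*) [Field k] {n : ℕ} {L : Type*} [AddCommGroup L] [Module k L]
  [Module (WeylAlgebra k n) L] [IsScalarTower k (WeylAlgebra k n) L] {s : ℕ} (e : Fin s → L)

/-- The exponents `μ` such that `x^α ∂^β e_t`, `μ = (α, β)`, is a linear combination of smaller
vectors; these are the leading exponents of the relations between the `e_t`. -/
def reducible (t : Fin s) : Set (Fin (n + n) → ℕ) :=
  {μ | vec k e (μ, t) ∈ Submodule.span k (vec k e '' {p | pairKey p < pairKey (μ, t)})}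

theorem isUpperSet_reducible (t : Fin s) : IsUpperSet (reducible (n := n) k e t) := by
  refine isUpperSet_of_add_single fun μ hμ q => ?_
  obtain ⟨z, ν, hν, h⟩ := exists_gens_smul_vec k e q (μ, t)
  set S := Submodule.span k
    (vec (n := n) k e '' {p | pairKey p < pairKey (μ + Pi.single q 1, t)})
  have hlow : ∀ p : (Fin (n + n) → ℕ) × Fin s, ∑ l, p.1 l ≤ ∑ l, μ l → vec k e p ∈ S :=
    fun p hp => Submodule.subset_span ⟨p, pairKey_lt_of_degree_lt (by
      rw [sum_add_single]; exact Nat.lt_succ_of_le hp), rfl⟩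
  have hle : Submodule.span k (vec (n := n) k e '' {p | pairKey p < pairKey (μ, t)}) ≤
      S.comap (act k (gens k q)) := by
    refine Submodule.span_le.2 ?_
    rintro _ ⟨p, hp, rfl⟩
    obtain ⟨z', ν', hν', h'⟩ := exists_gens_smul_vec k e q p
    change gens k q • vec k e p ∈ S
    rw [h']
    exact add_mem (Submodule.subset_span ⟨_, pairKey_add_single_lt q hp, rfl⟩)
      (zsmul_mem (hlow (ν', p.2) (hν'.trans (degree_le_of_pairKey_lt hp))) z')
  have h₁ : gens k q • vec k e (μ, t) ∈ S := hle hμ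
  change vec k e (μ + Pi.single q 1, t) ∈ S
  rw [← sub_eq_iff_eq_add] at h
  rw [← h]
  exact sub_mem h₁ (zsmul_mem (hlow (ν, t) hν) z)

omit [IsScalarTower k (WeylAlgebra k n) L] in
open Classical in
/-- The `x^α ∂^β e_t` of degree at most `j` with irreducible exponents form a basis of `Γ_j`. -/
theorem finrank_stepSpan_eq (j : ℕ) : Module.finrank k (stepSpan (n := n) k e j) =
    ∑ t, ((lowDegree (n + n) j).filter (· ∉ reducible k e t)).card := by
  rw [stepSpan, finrank_span_image_eq_card pairKey pairKey_injective]
  have h : ((lowPairs (n + n) s j).filter fun i => vec k e i ∉ Submodule.span k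
      (vec (n := n) k e '' {l | l ∈ lowPairs (n + n) s j ∧ pairKey l < pairKey i})) =
      (lowPairs (n + n) s j).filter fun i => i.1 ∉ reducible k e i.2 := by
    refine Finset.filter_congr fun i hi => ?_
    have : {l | l ∈ lowPairs (n + n) s j ∧ pairKey l < pairKey i} =
        {l | pairKey l < pairKey i} := by
      ext l
      simp only [Set.mem_ofPred_eq, and_iff_right_iff_imp]
      exact fun h => mem_lowPairs.2 ((degree_le_of_pairKey_lt h).trans (mem_lowPairs.1 hi))
    rw [this]
    rfl
  rw [h, Finset.card_eq_sum_card_fiberwise (f := Prod.snd) (t := Finset.univ)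
    (fun _ _ => Finset.mem_coe.2 (Finset.mem_univ _))]
  refine Finset.sum_congr rfl fun t _ => ?_
  refine Finset.card_nbij' Prod.fst (fun μ => (μ, t)) ?_ ?_ ?_ ?_
  · intro p hp
    simp only [Finset.coe_filter, Finset.mem_filter, mem_lowPairs, Set.mem_ofPred_eq,
      mem_lowDegree] at hp ⊢
    obtain ⟨⟨h₁, h₂⟩, rfl⟩ := hp
    exact ⟨h₁, h₂⟩
  · intro μ hμ
    simp only [Finset.coe_filter, Finset.mem_filter, mem_lowPairs, Set.mem_ofPred_eq,
      mem_lowDegree] at hμ ⊢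
    exact ⟨hμ, trivial⟩
  · intro p hp
    simp only [Finset.coe_filter, Set.mem_ofPred_eq] at hp
    exact Prod.ext rfl hp.2.symm
  · intro μ _
    rfl

/-- The Hilbert function of a finitely generated module is eventually polynomial. -/
theorem eventuallyPoly_finrank_stepSpan :
    EventuallyPoly fun j => Module.finrank k (stepSpan (n := n) k e j) := by
  classical
  simp only [finrank_stepSpan_eq]
  exact EventuallyPoly.sum _ fun t _ =>
    eventuallyPoly_card_compl (n + n) (isUpperSet_reducible k e t)

omit [IsScalarTower k (WeylAlgebra k n) L] in
theorem finrank_stepSpan_le (j : ℕ) :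
    Module.finrank k (stepSpan (n := n) k e j) ≤ s * (j + 1) ^ (n + n) := by
  classical
  rw [finrank_stepSpan_eq]
  calc _ ≤ ∑ _t : Fin s, (j + 1) ^ (n + n) := Finset.sum_le_sum fun t _ =>
        (Finset.card_filter_le _ _).trans (card_lowDegree_le _ _)
    _ = s * (j + 1) ^ (n + n) := by simp

end Reducible

/-! ### Bernstein's inequality -/

section Bernstein

variable (k : Type*) [Field k] {n : ℕ} {L : Type*} [AddCommGroup L] [Module k L]
  [Module (WeylAlgebra k n) L] [IsScalarTower k (WeylAlgebra k n) L]

theorem gens_mem_bernstein (q : Fin (n + n)) : gens k q ∈ bernstein k n 1 := by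
  obtain ⟨z, ν, hν, h⟩ := exists_gens_mul_mon k q 0
  rw [mon_zero, mul_one] at h
  rw [h]
  refine add_mem (mon_mem_bernstein k ?_) (zsmul_mem (mon_mem_bernstein k ?_) z)
  · rw [sum_add_single]
    simp
  · exact hν.trans (by simp)

/-- Up to sign, the commutator of a linear combination of monomials with a generator is its formal
derivative. -/
theorem commutator_sum_mon (q : Fin (n + n)) : ∃ ε : ℤ, ε ≠ 0 ∧
    ∀ (c : (Fin (n + n) → ℕ) → k) (i : ℕ),
      gens k (conj q) * (∑ μ ∈ lowDegree (n + n) (i + 1), c μ • mon k μ) -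
        (∑ μ ∈ lowDegree (n + n) (i + 1), c μ • mon k μ) * gens k (conj q) =
      ∑ ν ∈ lowDegree (n + n) i,
        (c (ν + Pi.single q 1) * ((ε * (ν q + 1) : ℤ) : k)) • mon k ν := by
  obtain ⟨ε, hε, h₁, h₂⟩ := exists_commutator_mon k q
  refine ⟨ε, hε, fun c i => ?_⟩
  rw [Finset.mul_sum, Finset.sum_mul, ← Finset.sum_sub_distrib, eq_comm]
  refine Finset.sum_of_injOn (fun ν => ν + Pi.single q 1) (add_left_injective _).injOn ?_ ?_ ?_
  · intro ν hν
    rw [Finset.mem_coe, mem_lowDegree] at hν ⊢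
    rw [sum_add_single]
    omega
  · intro μ hμ hμ'
    have h0 : μ q = 0 := by
      by_contra h0
      obtain ⟨ν, rfl⟩ := exists_add_single h0
      refine hμ' ⟨ν, ?_, rfl⟩
      rw [mem_lowDegree, sum_add_single] at hμ
      rw [Finset.mem_coe, mem_lowDegree]
      omega
    rw [mul_smul_comm, smul_mul_assoc, h₂ μ h0, sub_self]
  · intro ν _
    rw [mul_smul_comm, smul_mul_assoc, ← smul_sub, h₁, mul_smul, Int.cast_smul_eq_zsmul]

variable {k} in
/-- In characteristic `0`, an element of `B_i` that annihilates `Γ_i ≠ 0` has zero coefficients: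
its commutators with the generators annihilate `Γ_{i-1}`. -/
theorem coeff_eq_zero_of_annihilates [CharZero k] (Γ : Filtration k n L) {y₀ : L}
    (hy₀ : y₀ ∈ Γ.step 0) (hy₀' : y₀ ≠ 0) (i : ℕ) (c : (Fin (n + n) → ℕ) → k)
    (h : ∀ y ∈ Γ.step i, (∑ μ ∈ lowDegree (n + n) i, c μ • mon k μ) • y = 0) :
    ∀ μ ∈ lowDegree (n + n) i, c μ = 0 := by
  induction i generalizing c with
  | zero =>
    have hlow : lowDegree (n + n) 0 = {0} := by
      ext μ
      rw [mem_lowDegree, Nat.le_zero, Finset.sum_eq_zero_iff, Finset.mem_singleton]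
      exact ⟨fun h => funext fun l => h l (Finset.mem_univ l), fun h l _ => by simp [h]⟩
    intro μ hμ
    rw [hlow, Finset.mem_singleton] at hμ
    have := h y₀ hy₀
    rw [hlow, Finset.sum_singleton, mon_zero, smul_assoc, one_smul] at this
    exact hμ ▸ (smul_eq_zero.1 this).resolve_right hy₀'
  | succ i ih =>
    have hne : ∀ μ ∈ lowDegree (n + n) (i + 1), μ ≠ 0 → c μ = 0 := by
      intro μ hμ hμ0
      obtain ⟨q, hq⟩ := Function.ne_iff.1 hμ0
      obtain ⟨ν, rfl⟩ := exists_add_single hq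
      obtain ⟨ε, hε, hc⟩ := commutator_sum_mon k q
      have hν : ν ∈ lowDegree (n + n) i := by
        rw [mem_lowDegree, sum_add_single] at hμ
        rw [mem_lowDegree]
        omega
      have h₀ := ih (fun ν => c (ν + Pi.single q 1) * ((ε * (ν q + 1) : ℤ) : k)) (fun y hy => by
        have hg := Γ.smul_mem (gens_mem_bernstein k (conj q)) hy
        rw [add_comm] at hg
        rw [← hc, sub_smul, mul_smul, mul_smul, h _ (Γ.mono (Nat.le_succ i) hy), h _ hg,
          smul_zero, sub_zero]) ν hν
      refine (mul_eq_zero.1 h₀).resolve_right (Int.cast_ne_zero.2 (mul_ne_zero hε ?_))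
      positivity
    intro μ hμ
    by_cases hμ0 : μ = 0
    · have := h y₀ (Γ.mono (Nat.zero_le _) hy₀)
      rw [Finset.sum_eq_single_of_mem (0 : Fin (n + n) → ℕ) (mem_lowDegree.2 (by simp))
        (fun μ hμ hμ0 => by rw [hne μ hμ hμ0, zero_smul]), mon_zero, smul_assoc, one_smul] at this
      exact hμ0 ▸ (smul_eq_zero.1 this).resolve_right hy₀'
    · exact hne μ hμ hμ0

variable {k} in
/-- The monomials of degree at most `i` are linearly independent as maps `Γ_i → Γ_{2i}`. -/
theorem card_lowDegree_le_finrank_mul [CharZero k] (Γ : Filtration k n L) {y₀ : L}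
    (hy₀ : y₀ ∈ Γ.step 0) (hy₀' : y₀ ≠ 0) (i : ℕ) :
    (lowDegree (n + n) i).card ≤
      Module.finrank k (Γ.step i) * Module.finrank k (Γ.step (i + i)) := by
  have := Γ.finite
  rw [← Module.finrank_linearMap k k, ← Fintype.card_coe]
  refine LinearIndependent.fintype_card_le_finrank (R := k)
    (b := fun μ : lowDegree (n + n) i =>
      Γ.mulStep (mon_mem_bernstein k (mem_lowDegree.1 μ.2)) i) ?_
  rw [Fintype.linearIndependent_iff]
  intro c hc
  classical
  have h := coeff_eq_zero_of_annihilates Γ hy₀ hy₀' i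
    (fun μ => if hμ : μ ∈ lowDegree (n + n) i then c ⟨μ, hμ⟩ else 0) (fun y hy => ?_)
  · intro μ
    simpa using h μ μ.2
  · have h₁ := congrArg Subtype.val (LinearMap.congr_fun hc ⟨y, hy⟩)
    rw [← Finset.sum_coe_sort, Finset.sum_smul]
    rw [LinearMap.sum_apply, AddSubmonoidClass.coe_finsetSum] at h₁
    refine Eq.trans (Finset.sum_congr rfl fun μ _ => ?_) h₁
    rw [dif_pos μ.2, smul_assoc]
    rfl

theorem mul_add_one_pow_le (w j d : ℕ) : (w * j + 1) ^ d ≤ (w + 1) ^ d * (j + 1) ^ d := by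
  rw [← mul_pow]
  exact Nat.pow_le_pow_left (by nlinarith) d

variable {k} in
/-- Bernstein's inequality: a nonzero `A_n(k)`-module does not grow more slowly than `j^n`. -/
theorem le_of_finrank_step_le [CharZero k] (Γ : Filtration k n L) {y₀ : L}
    (hy₀ : y₀ ∈ Γ.step 0) (hy₀' : y₀ ≠ 0) {C d : ℕ}
    (h : ∀ j, Module.finrank k (Γ.step j) ≤ C * (j + 1) ^ d) : n ≤ d := by
  by_contra! hd
  set r := n + n with hr
  set K := C * (r + 1) ^ d * (C * (2 * r + 1) ^ d) with hK
  have key : ∀ q, (q + 1) ^ r ≤ K * (q + 1) ^ (d + d) := by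
    intro q
    calc (q + 1) ^ r ≤ (lowDegree r (r * q)).card := le_card_lowDegree r q
      _ ≤ Module.finrank k (Γ.step (r * q)) * Module.finrank k (Γ.step (r * q + r * q)) :=
        card_lowDegree_le_finrank_mul Γ hy₀ hy₀' _
      _ ≤ (C * ((r + 1) ^ d * (q + 1) ^ d)) * (C * ((2 * r + 1) ^ d * (q + 1) ^ d)) := by
        refine Nat.mul_le_mul ((h _).trans ?_) ((h _).trans ?_)
        · exact Nat.mul_le_mul_left _ (mul_add_one_pow_le _ _ _)
        · rw [← two_mul, ← mul_assoc]
          exact Nat.mul_le_mul_left _ (mul_add_one_pow_le _ _ _)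
      _ = K * (q + 1) ^ (d + d) := by rw [hK, pow_add]; ring
  -- As `2d + 1 ≤ r`, the bound `key` fails as soon as `q + 1 > K`.
  have h₁ := key K
  have h₂ : (K + 1) ^ (d + d + 1) ≤ (K + 1) ^ r := Nat.pow_le_pow_right (Nat.succ_pos K) (by omega)
  have h₃ := h₂.trans h₁
  rw [pow_succ, mul_comm] at h₃
  have := Nat.le_of_mul_le_mul_right h₃ (by positivity)
  omega

end Bernstein

/-! ### Dimension from growth -/

theorem natDegree_le_of_eval_le (p : Polynomial ℚ) (C d : ℕ)
    (h : ∀ᶠ j : ℕ in Filter.atTop, |p.eval (j : ℚ)| ≤ C * ((j : ℚ) + 1) ^ d) :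
    p.natDegree ≤ d := by
  by_contra! hd
  have hQ : ((Polynomial.X + 1 : Polynomial ℚ) ^ d).Monic := by
    simpa using (Polynomial.monic_X_add_C (1 : ℚ)).pow d
  have hdeg : ((Polynomial.X + 1 : Polynomial ℚ) ^ d).degree < p.degree := by
    refine Polynomial.degree_lt_degree ?_
    rw [Polynomial.natDegree_pow]
    have : (Polynomial.X + 1 : Polynomial ℚ).natDegree = 1 := by
      simpa using Polynomial.natDegree_X_add_C (1 : ℚ)
    rw [this]
    omega
  have ht := (Polynomial.abs_div_tendsto_atTop_atTop_of_degree_gt p _ hdeg hQ.ne_zero).comp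
    (tendsto_natCast_atTop_atTop (R := ℚ))
  obtain ⟨j, hj, hj'⟩ := (h.and (ht.eventually_gt_atTop (C : ℚ))).exists
  have hpos : (0 : ℚ) < ((j : ℚ) + 1) ^ d := by positivity
  rw [Function.comp_apply, abs_div] at hj'
  simp only [Polynomial.eval_pow, Polynomial.eval_add, Polynomial.eval_X,
    Polynomial.eval_one] at hj'
  rw [abs_of_pos hpos, lt_div_iff₀ hpos] at hj'
  exact absurd hj (not_le.2 hj')

theorem exists_eval_le (p : Polynomial ℚ) :
    ∃ C : ℕ, ∀ j : ℕ, p.eval (j : ℚ) ≤ C * ((j : ℚ) + 1) ^ p.natDegree := by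
  obtain ⟨C, hC⟩ := exists_nat_ge (∑ i ∈ Finset.range (p.natDegree + 1), |p.coeff i|)
  refine ⟨C, fun j => ?_⟩
  refine le_trans ?_ (mul_le_mul_of_nonneg_right hC (by positivity))
  rw [Polynomial.eval_eq_sum_range, Finset.sum_mul]
  refine Finset.sum_le_sum fun i hi => ?_
  refine mul_le_mul (le_abs_self _) ?_ (by positivity) (abs_nonneg _)
  calc (j : ℚ) ^ i ≤ ((j : ℚ) + 1) ^ i := by gcongr; simp
    _ ≤ ((j : ℚ) + 1) ^ p.natDegree :=
      pow_le_pow_right₀ (by simp) (Nat.lt_succ_iff.1 (Finset.mem_range.1 hi))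

section Dimension

variable {k : Type*} [Field k] [CharZero k] {n : ℕ} {L : Type*} [AddCommGroup L] [Module k L]
  [Module (WeylAlgebra k n) L] [IsScalarTower k (WeylAlgebra k n) L] {s : ℕ} {e : Fin s → L}

theorem exists_ne_zero_of_span_eq_top {R : Type*} [Ring R] {L : Type*} [AddCommGroup L]
    [Module R L] [Nontrivial L] {ι : Type*} {e : ι → L}
    (he : Submodule.span R (Set.range e) = ⊤) : ∃ t, e t ≠ 0 := by
  by_contra! h
  refine bot_ne_top (α := Submodule R L) (he ▸ Eq.symm (Submodule.span_eq_bot.2 ?_))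
  rintro _ ⟨t, rfl⟩
  exact h t

theorem le_of_finrank_stepSpan_le [Nontrivial L]
    (he : Submodule.span (WeylAlgebra k n) (Set.range e) = ⊤) {C d : ℕ}
    (h : ∀ j, Module.finrank k (stepSpan (n := n) k e j) ≤ C * (j + 1) ^ d) : n ≤ d := by
  obtain ⟨t, ht⟩ := exists_ne_zero_of_span_eq_top he
  exact le_of_finrank_step_le (stdFiltration k he) (e_mem_stepSpan k t) ht h

omit [CharZero k] [IsScalarTower k (WeylAlgebra k n) L] in
theorem finrank_stepSpan_pos [Nontrivial L]
    (he : Submodule.span (WeylAlgebra k n) (Set.range e) = ⊤) (j : ℕ) :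
    0 < Module.finrank k (stepSpan (n := n) k e j) := by
  obtain ⟨t, ht⟩ := exists_ne_zero_of_span_eq_top he
  have : Nontrivial (stepSpan (n := n) k e j) :=
    ⟨⟨⟨e t, stepSpan_mono k e (Nat.zero_le j) (e_mem_stepSpan k t)⟩, 0,
      fun h => ht (congrArg Subtype.val h)⟩⟩
  exact Module.finrank_pos

/-- A nonzero module growing at most like `j^n` has dimension `n`, by Bernstein's inequality. -/
theorem hasDimension_of_finrank_stepSpan_le [Nontrivial L]
    (he : Submodule.span (WeylAlgebra k n) (Set.range e) = ⊤) {C : ℕ}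
    (h : ∀ j, Module.finrank k (stepSpan (n := n) k e j) ≤ C * (j + 1) ^ n) :
    HasDimension k n L n := by
  obtain ⟨p, hp⟩ := eventuallyPoly_finrank_stepSpan (n := n) k e
  refine ⟨stdFiltration k he, stdFiltration_isGood k he, p, ?_, hp⟩
  have hle : p.natDegree ≤ n := by
    refine natDegree_le_of_eval_le p C n ?_
    filter_upwards [hp] with j hj
    rw [← hj, abs_of_nonneg (Nat.cast_nonneg _)]
    exact_mod_cast h j
  have hge : n ≤ p.natDegree := by
    obtain ⟨j₀, hj₀⟩ := Filter.eventually_atTop.1 hp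
    obtain ⟨C', hC'⟩ := exists_eval_le p
    refine le_of_finrank_stepSpan_le he
      (C := C' + Module.finrank k (stepSpan (n := n) k e j₀)) (d := p.natDegree) fun j => ?_
    rw [add_mul]
    rcases le_total j₀ j with hj | hj
    · refine le_add_right ?_
      have h₁ := hj₀ j hj ▸ hC' j
      exact_mod_cast h₁
    · refine le_add_left ((Submodule.finrank_mono (stepSpan_mono k e hj)).trans ?_)
      exact Nat.le_mul_of_pos_right _ (by positivity)
  have hp0 : p ≠ 0 := by
    rintro rfl
    obtain ⟨j, hj⟩ := hp.exists
    rw [Polynomial.eval_zero, Nat.cast_eq_zero] at hj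
    exact (finrank_stepSpan_pos he j).ne' hj
  rw [Polynomial.degree_eq_natDegree hp0, le_antisymm hle hge]

end Dimension

/-! ### Modules over two Weyl algebras -/

section TwoActions

variable {k : Type*} [Field k] {n N : ℕ} {L : Type*} [AddCommGroup L] [Module k L]
  [Module (WeylAlgebra k n) L] [IsScalarTower k (WeylAlgebra k n) L]
  [Module (WeylAlgebra k N) L] [IsScalarTower k (WeylAlgebra k N) L]

variable (k n N L) in
/-- The action of `A_N(k)` on `L` extends that of `A_n(k)`: each generator of `A_n(k)` acts as a
generator of `A_N(k)`, and each other generator of `A_N(k)` commutes with the action of `A_n(k)`. -/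
structure ExtendsAction : Prop where
  exists_gens (p : Fin (n + n)) : ∃ q : Fin (N + N), ∀ y : L, gens k p • y = gens k q • y
  gens_or_commute (q : Fin (N + N)) : (∃ p : Fin (n + n), ∀ y : L, gens k q • y = gens k p • y) ∨
    ∀ (a : WeylAlgebra k n) (y : L), gens k q • a • y = a • gens k q • y

variable {s : ℕ} {e : Fin s → L}

theorem ExtendsAction.span_eq_top (h : ExtendsAction k n N L)
    (he : Submodule.span (WeylAlgebra k n) (Set.range e) = ⊤) :
    Submodule.span (WeylAlgebra k N) (Set.range e) = ⊤ := by
  refine eq_top_iff.2 fun y _ => ?_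
  have hy : y ∈ Submodule.span (WeylAlgebra k n) (Set.range e) := he ▸ Submodule.mem_top
  induction hy using Submodule.span_induction with
  | mem y hy => exact Submodule.subset_span hy
  | zero => exact zero_mem _
  | add y z _ _ hy hz => exact add_mem (hy trivial) (hz trivial)
  | smul a y _ hy =>
    refine mul_mem_of_gens_mul_mem k (AlgHom.id k (WeylAlgebra k n))
      ((Submodule.span (WeylAlgebra k N) (Set.range e)).restrictScalars k) (fun p y hy => ?_) a y
      (hy trivial)
    obtain ⟨q, hq⟩ := h.exists_gens p
    rw [AlgHom.id_apply, hq]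
    exact Submodule.smul_mem _ (gens k q) hy

theorem ExtendsAction.gens_smul_mem (h : ExtendsAction k n N L) {q : Fin (N + N)} {w j : ℕ}
    (hw : ∀ t, gens k q • e t ∈ stepSpan (n := n) k e w) {y : L}
    (hy : y ∈ stepSpan (n := n) k e j) (hw₁ : 1 ≤ w) :
    gens k q • y ∈ stepSpan (n := n) k e (w + j) := by
  rcases h.gens_or_commute q with ⟨p, hp⟩ | hq
  · rw [hp]
    exact stepSpan_mono (n := n) k e (by omega) (gens_smul_mem_stepSpan (n := n) k p hy)
  · suffices h : stepSpan (n := n) k e j ≤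
        (stepSpan (n := n) k e (w + j)).comap (act k (gens k q) : L →ₗ[k] L) from h hy
    refine (stepSpan_le_iff (n := n) k).2 fun p hp => ?_
    change gens k q • mon k p.1 • e p.2 ∈ stepSpan (n := n) k e (w + j)
    rw [hq, add_comm w]
    exact bernstein_smul_mem (n := n) k (mon_mem_bernstein k hp) (hw p.2)

/-- If `L` is finitely generated over `A_n(k)`, its filtration over `A_N(k)` grows no faster than
that over `A_n(k)`, up to a linear change of the index. -/
theorem ExtendsAction.exists_stepSpan_le (h : ExtendsAction k n N L)
    (he : Submodule.span (WeylAlgebra k n) (Set.range e) = ⊤) :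
    ∃ w : ℕ, ∀ j, stepSpan (n := N) k e j ≤ stepSpan (n := n) k e (w * j) := by
  have hmem : ∀ y : L, ∃ w, y ∈ stepSpan (n := n) k e w := fun y =>
    (Submodule.mem_iSup_of_directed _ (stepSpan_mono k e).directed_le).1
      (iSup_stepSpan (n := n) k he ▸ Submodule.mem_top)
  choose w hw using fun (q : Fin (N + N)) (t : Fin s) => hmem (gens k q • e t)
  obtain ⟨W, hW, hwW⟩ : ∃ W, 1 ≤ W ∧ ∀ q t, w q t ≤ W := by
    refine ⟨1 + ∑ q, ∑ t, w q t, Nat.le_add_right _ _, fun q t => ?_⟩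
    exact ((Finset.single_le_sum (f := w q) (fun _ _ => Nat.zero_le _) (Finset.mem_univ t)).trans
      (Finset.single_le_sum (f := fun q => ∑ t, w q t) (fun _ _ => Nat.zero_le _)
        (Finset.mem_univ q))).trans (Nat.le_add_left _ _)
  have hgens : ∀ q : Fin (N + N), ∀ j, ∀ y ∈ stepSpan (n := n) k e j,
      gens k q • y ∈ stepSpan (n := n) k e (W + j) := fun q j y hy =>
    h.gens_smul_mem (fun t => stepSpan_mono (n := n) k e (hwW q t) (hw q t)) hy hW
  refine ⟨W, fun j => (stepSpan_le_iff (n := N) k).2 fun p hp => ?_⟩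
  have hp' := mon_smul_mem_of_gens (n := N) k (stepSpan (n := n) k e)
    (stepSpan_mono (n := n) k e) W hgens j p.1 hp (e_mem_stepSpan (n := n) k p.2)
  exact hp'

theorem ExtendsAction.exists_finrank_le (h : ExtendsAction k n N L)
    (he : Submodule.span (WeylAlgebra k n) (Set.range e) = ⊤) {C d : ℕ}
    (hC : ∀ j, Module.finrank k (stepSpan (n := n) k e j) ≤ C * (j + 1) ^ d) :
    ∃ w, ∀ j, Module.finrank k (stepSpan (n := N) k e j) ≤ C * (w + 1) ^ d * (j + 1) ^ d := by
  obtain ⟨w, hw⟩ := h.exists_stepSpan_le he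
  refine ⟨w, fun j => (Submodule.finrank_mono (hw j)).trans ((hC _).trans ?_)⟩
  rw [mul_assoc]
  exact Nat.mul_le_mul_left _ (mul_add_one_pow_le _ _ _)

end TwoActions

section DoubleAction

variable {k : Type*} [Field k] {n : ℕ} {L : Type*} [AddCommGroup L] [Module k L]
  [Module (WeylAlgebra k n) L] [IsScalarTower k (WeylAlgebra k n) L]

theorem ExtendsAction.isHolonomic [CharZero k] [Module (WeylAlgebra k (n + n)) L]
    [IsScalarTower k (WeylAlgebra k (n + n)) L] (h : ExtendsAction k n (n + n) L)
    [hfin : Module.Finite (WeylAlgebra k n) L] : IsHolonomic k (n + n) L := by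
  obtain ⟨s, e, he⟩ := Module.Finite.exists_fin (R := WeylAlgebra k n) (M := L)
  have he' := h.span_eq_top he
  refine ⟨⟨⟨(Set.finite_range e).toFinset, by simpa using he'⟩⟩, ?_⟩
  rcases subsingleton_or_nontrivial L with hL | hL
  · exact Or.inl hL
  · obtain ⟨w, hw⟩ := h.exists_finrank_le he (finrank_stepSpan_le (n := n) k e)
    exact Or.inr ⟨hL, hasDimension_of_finrank_stepSpan_le he' hw⟩

/-- The exponent of the leading monomial of a nonzero annihilator of `e_t` is reducible. -/
theorem exists_mem_reducible {s : ℕ} {e : Fin s → L} {t : Fin s} {a : WeylAlgebra k n} (ha : a ≠ 0) (hae : a • e t = 0) :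
    ∃ μ, μ ∈ reducible (n := n) k e t := by
  obtain ⟨c, hc⟩ := Finsupp.mem_span_range_iff_exists_finsupp.1
    (show a ∈ Submodule.span k (Set.range (mon k (n := n))) from span_mon k ▸ Submodule.mem_top)
  have hne : c.support.Nonempty := by
    rw [Finsupp.support_nonempty_iff]
    rintro rfl
    exact ha (by simpa using hc.symm)
  -- `μ₀` is the exponent of the leading monomial of `a`.
  obtain ⟨μ₀, hμ₀, hmax⟩ := Finset.exists_max_image c.support (fun μ => pairKey (μ, t)) hne
  refine ⟨μ₀, ?_⟩
  rw [← hc, Finsupp.sum, Finset.sum_smul, ← Finset.add_sum_erase _ _ hμ₀, smul_assoc] at hae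
  change mon k μ₀ • e t ∈
    Submodule.span k (vec (n := n) k e '' {p | pairKey p < pairKey (μ₀, t)})
  refine (Submodule.smul_mem_iff _ (Finsupp.mem_support_iff.1 hμ₀)).1 ?_
  rw [eq_neg_of_add_eq_zero_left hae]
  refine neg_mem (sum_mem fun μ hμ => ?_)
  rw [smul_assoc]
  refine Submodule.smul_mem _ _ (Submodule.subset_span ⟨(μ, t), ?_, rfl⟩)
  obtain ⟨h₁, h₂⟩ := Finset.mem_erase.1 hμ
  refine (hmax μ h₂).lt_of_ne fun h => h₁ ?_
  exact congrArg Prod.fst (pairKey_injective h)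

/-- A relation on the generator of a cyclic `A_n(k)`-module makes it grow more slowly than
`j^(2n)`, which Bernstein's inequality over `A_{2n}(k)` forbids. -/
theorem ExtendsAction.eq_zero_of_smul_eq_zero [CharZero k] [Nontrivial L]
    [Module (WeylAlgebra k (n + n)) L] [IsScalarTower k (WeylAlgebra k (n + n)) L]
    (h : ExtendsAction k n (n + n) L) {m : L}
    (hm : Submodule.span (WeylAlgebra k n) {m} = ⊤) {a : WeylAlgebra k n} (ha : a • m = 0) :
    a = 0 := by
  classical
  by_contra ha0
  let e : Fin 1 → L := fun _ => m
  have he : Submodule.span (WeylAlgebra k n) (Set.range e) = ⊤ := by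
    rwa [Set.range_const]
  obtain ⟨μ₀, hμ₀⟩ := exists_mem_reducible (e := e) (t := 0) ha0 ha
  have hle : ∀ j, Module.finrank k (stepSpan (n := n) k e j) ≤
      (∑ i, μ₀ i) * (j + 1) ^ (n + n - 1) := by
    intro j
    rw [finrank_stepSpan_eq, Fin.sum_univ_one]
    refine le_trans (Finset.card_le_card ?_) (card_lowDegree_not_ge (n + n) j μ₀)
    refine Finset.monotone_filter_right _ fun μ _ hμ hle => hμ ?_
    exact isUpperSet_reducible k e 0 hle hμ₀
  -- For `n = 0` the exponent `2n - 1` is truncated, but then `∑ i, μ₀ i = 0`.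
  have hn : n ≠ 0 := by
    intro hn
    have h₁ := hle 0
    have h₂ := finrank_stepSpan_pos he 0
    have : IsEmpty (Fin (n + n)) := by
      rw [hn]
      exact Fin.isEmpty
    simp only [Finset.univ_eq_empty, Finset.sum_empty, zero_mul] at h₁
    omega
  obtain ⟨w, hw⟩ := h.exists_finrank_le he hle
  have := le_of_finrank_stepSpan_le (h.span_eq_top he) hw
  omega

end DoubleAction

/-! ### Modules with commuting actions through algebra homomorphisms -/

section Homs

variable {k : Type*} [Field k] {n N : ℕ} {R : Type*} [Ring R] [Algebra k R]
  {L : Type*} [AddCommGroup L] [Module k L] [Module R L] [IsScalarTower k R L]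

theorem isScalarTower_compHom {A : Type*} [Ring A] [Algebra k A] (f : A →ₐ[k] R) :
    letI := Module.compHom L f.toRingHom
    IsScalarTower k A L := by
  let := Module.compHom L f.toRingHom
  refine ⟨fun c a y => ?_⟩
  change f (c • a) • y = c • f a • y
  rw [map_smul, smul_assoc]

/-- The image of `A_N(k)` in `R` extends that of `A_n(k)`: each generator of `A_n(k)` goes to the
image of a generator of `A_N(k)`, and each other generator of `A_N(k)` goes to an element commuting
with the image of `A_n(k)`. -/
structure ExtendsHom (f : WeylAlgebra k n →ₐ[k] R) (g : WeylAlgebra k N →ₐ[k] R) : Prop where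
  exists_gens (p : Fin (n + n)) : ∃ q : Fin (N + N), f (gens k p) = g (gens k q)
  gens_or_commute (q : Fin (N + N)) : (∃ p : Fin (n + n), g (gens k q) = f (gens k p)) ∨
    ∀ a : WeylAlgebra k n, Commute (g (gens k q)) (f a)

omit [Module k L] [IsScalarTower k R L] in
variable (L) in
theorem ExtendsHom.extendsAction {f : WeylAlgebra k n →ₐ[k] R} {g : WeylAlgebra k N →ₐ[k] R}
    (h : ExtendsHom f g) :
    letI := Module.compHom L f.toRingHom
    letI := Module.compHom L g.toRingHom
    ExtendsAction k n N L := by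
  let := Module.compHom L f.toRingHom
  let := Module.compHom L g.toRingHom
  refine ⟨fun p => ?_, fun q => ?_⟩
  · obtain ⟨q, hq⟩ := h.exists_gens p
    exact ⟨q, fun y => congrArg (· • y) hq⟩
  · rcases h.gens_or_commute q with ⟨p, hp⟩ | hq
    · exact Or.inl ⟨p, fun y => congrArg (· • y) hp⟩
    · refine Or.inr fun a y => ?_
      change g (gens k q) • f a • y = f a • g (gens k q) • y
      rw [smul_smul, (hq a).eq, mul_smul]

variable [CharZero k] {f : WeylAlgebra k n →ₐ[k] R} {g : WeylAlgebra k (n + n) →ₐ[k] R}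

theorem ExtendsHom.isHolonomic (h : ExtendsHom f g) {s : ℕ} {e : Fin s → L}
    (he : ∀ y : L, ∃ c : Fin s → WeylAlgebra k n, ∑ t, f (c t) • e t = y) :
    letI := Module.compHom L g.toRingHom
    haveI := isScalarTower_compHom (L := L) g
    IsHolonomic k (n + n) L := by
  let i₁ := Module.compHom L f.toRingHom
  let i₂ := Module.compHom L g.toRingHom
  have := isScalarTower_compHom (L := L) f
  have := isScalarTower_compHom (L := L) g
  have hspan : Submodule.span (WeylAlgebra k n) (Set.range e) = ⊤ :=
    eq_top_iff.2 fun y _ => (Submodule.mem_span_range_iff_exists_fun _).2 (he y)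
  have : Module.Finite (WeylAlgebra k n) L :=
    ⟨⟨(Set.finite_range e).toFinset, by simpa using hspan⟩⟩
  exact (h.extendsAction L).isHolonomic

theorem ExtendsHom.eq_zero_of_smul_eq_zero [Nontrivial L] (h : ExtendsHom f g) {m : L}
    (hm : ∀ y : L, ∃ a, f a • m = y) {a : WeylAlgebra k n} (ha : f a • m = 0) : a = 0 := by
  let i₁ := Module.compHom L f.toRingHom
  let i₂ := Module.compHom L g.toRingHom
  have := isScalarTower_compHom (L := L) f
  have := isScalarTower_compHom (L := L) g
  refine (h.extendsAction L).eq_zero_of_smul_eq_zero (m := m) ?_ ha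
  exact eq_top_iff.2 fun y _ => Submodule.mem_span_singleton.2 (hm y)

/-- A proper nonzero submodule would contain some `f a • m` with `a ≠ 0`, which vanishes in the
quotient although the quotient is again cyclic over `A_n(k)`. -/
theorem ExtendsHom.isSimpleModule [Nontrivial L] (h : ExtendsHom f g) {m : L}
    (hm : ∀ y : L, ∃ a, f a • m = y) : IsSimpleModule R L := by
  rw [isSimpleModule_iff]
  refine { eq_bot_or_eq_top := fun P => or_iff_not_imp_left.2 fun hP => ?_ }
  obtain ⟨y, hy, hy0⟩ := Submodule.exists_mem_ne_zero_of_ne_bot hP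
  obtain ⟨a, rfl⟩ := hm y
  by_contra hP'
  have : Nontrivial (L ⧸ P) := Submodule.Quotient.nontrivial_iff.2 hP'
  have hm' : ∀ z : L ⧸ P, ∃ a, f a • (Submodule.Quotient.mk m : L ⧸ P) = z := by
    intro z
    obtain ⟨z, rfl⟩ := Submodule.Quotient.mk_surjective _ z
    obtain ⟨a, rfl⟩ := hm z
    exact ⟨a, rfl⟩
  have ha := h.eq_zero_of_smul_eq_zero hm' (a := a) ((Submodule.Quotient.mk_eq_zero P).2 hy)
  exact hy0 (by rw [ha, map_zero, zero_smul])

end Homs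

/-! ### The two actions on a bimodule -/

section Bimodules

variable (k : Type*) [Field k] (n : ℕ)

/-- The transposition `x_i ↦ x_i`, `∂_i ↦ -∂_i`, an anti-automorphism of `A_n(k)`. -/
noncomputable def transpose : WeylAlgebra k n →ₐ[k] (WeylAlgebra k n)ᵐᵒᵖ :=
  lift (fun i => MulOpposite.op (X k i)) (fun i => MulOpposite.op (-D k i))
    (fun i j => by rw [← MulOpposite.op_mul, ← MulOpposite.op_mul, ← MulOpposite.op_sub,
      X_mul_X, MulOpposite.op_zero])
    (fun i j => by rw [← MulOpposite.op_mul, ← MulOpposite.op_mul, ← MulOpposite.op_sub,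
      neg_mul_neg, neg_mul_neg, D_mul_D, MulOpposite.op_zero])
    (fun i j => by
      have h : X k j * (-D k i) - (-D k i) * X k j = if i = j then 1 else 0 := by
        rw [← D_mul_X k i j]
        noncomm_ring
      rw [← MulOpposite.op_mul, ← MulOpposite.op_mul, ← MulOpposite.op_sub, h]
      split_ifs <;> rfl)

theorem transpose_X (i : Fin n) : transpose k n (X k i) = MulOpposite.op (X k i) :=
  lift_X _ _ _ _ _ i

theorem transpose_D (i : Fin n) : transpose k n (D k i) = MulOpposite.op (-D k i) :=
  lift_D _ _ _ _ _ i

theorem transpose_surjective : Function.Surjective (transpose k n) := by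
  intro b
  have h := mul_mem_of_gens_mul_mem k (AlgHom.id k (WeylAlgebra k n))
    ((Subalgebra.toSubmodule (transpose k n).range).comap
      (MulOpposite.opLinearEquiv k).toLinearMap) (fun q y hy => ?_) b.unop 1 ⟨1, map_one _⟩
  · obtain ⟨a, ha⟩ := h
    refine ⟨a, ha.trans ?_⟩
    change MulOpposite.op (b.unop * 1) = b
    rw [mul_one, MulOpposite.op_unop]
  · obtain ⟨a, ha⟩ := hy
    replace ha : transpose k n a = MulOpposite.op y := ha
    induction q using Fin.addCases with
    | left i =>
      refine ⟨a * X k i, ?_⟩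
      change transpose k n (a * X k i) = MulOpposite.op (gens k (Fin.castAdd n i) * y)
      rw [map_mul, ha, transpose_X, gens_castAdd, MulOpposite.op_mul]
    | right i =>
      refine ⟨-(a * D k i), ?_⟩
      change transpose k n (-(a * D k i)) = MulOpposite.op (gens k (Fin.natAdd n i) * y)
      rw [map_neg, map_mul, ha, transpose_D, gens_natAdd, MulOpposite.op_mul,
        MulOpposite.op_neg, mul_neg, neg_neg]

/-- The left action `a ↦ a ⊗ 1`. -/
noncomputable def leftHom :
    WeylAlgebra k n →ₐ[k] WeylAlgebra k n ⊗[k] (WeylAlgebra k n)ᵐᵒᵖ :=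
  Algebra.TensorProduct.includeLeft

/-- The right action, as a left action through the transposition: `a ↦ 1 ⊗ aᵗ`. -/
noncomputable def rightHom :
    WeylAlgebra k n →ₐ[k] WeylAlgebra k n ⊗[k] (WeylAlgebra k n)ᵐᵒᵖ :=
  Algebra.TensorProduct.includeRight.comp (transpose k n)

theorem leftHom_apply (a : WeylAlgebra k n) : leftHom k n a = a ⊗ₜ 1 := rfl

theorem rightHom_apply (a : WeylAlgebra k n) : rightHom k n a = 1 ⊗ₜ transpose k n a := rfl

theorem commute_leftHom_rightHom (a b : WeylAlgebra k n) :
    Commute (leftHom k n a) (rightHom k n b) := by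
  rw [leftHom_apply, rightHom_apply, commute_iff_eq, Algebra.TensorProduct.tmul_mul_tmul,
    Algebra.TensorProduct.tmul_mul_tmul, one_mul, mul_one, mul_one, one_mul]

theorem toEnveloping_X_castAdd (i : Fin n) :
    toEnveloping k n (X k (Fin.castAdd n i)) = leftHom k n (X k i) :=
  (lift_X _ _ _ _ _ _).trans (Fin.addCases_left i)

theorem toEnveloping_X_natAdd (i : Fin n) :
    toEnveloping k n (X k (Fin.natAdd n i)) = rightHom k n (X k i) := by
  rw [rightHom_apply, transpose_X]
  exact (lift_X _ _ _ _ _ _).trans (Fin.addCases_right i)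

theorem toEnveloping_D_castAdd (i : Fin n) :
    toEnveloping k n (D k (Fin.castAdd n i)) = leftHom k n (D k i) :=
  (lift_D _ _ _ _ _ _).trans (Fin.addCases_left i)

theorem toEnveloping_D_natAdd (i : Fin n) :
    toEnveloping k n (D k (Fin.natAdd n i)) = rightHom k n (D k i) := by
  rw [rightHom_apply, transpose_D]
  exact (lift_D _ _ _ _ _ _).trans (Fin.addCases_right i)

/-- Each generator of `A_{2n}(k)` acts as a generator from the left or from the right. -/
theorem toEnveloping_gens (q : Fin (n + n + (n + n))) :
    (∃ p, toEnveloping k n (gens k q) = leftHom k n (gens k p)) ∨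
      ∃ p, toEnveloping k n (gens k q) = rightHom k n (gens k p) := by
  induction q using Fin.addCases with
  | left i =>
    rw [gens_castAdd]
    induction i using Fin.addCases with
    | left i => exact Or.inl ⟨Fin.castAdd n i, by rw [gens_castAdd, toEnveloping_X_castAdd]⟩
    | right i => exact Or.inr ⟨Fin.castAdd n i, by rw [gens_castAdd, toEnveloping_X_natAdd]⟩
  | right i =>
    rw [gens_natAdd]
    induction i using Fin.addCases with
    | left i => exact Or.inl ⟨Fin.natAdd n i, by rw [gens_natAdd, toEnveloping_D_castAdd]⟩
    | right i => exact Or.inr ⟨Fin.natAdd n i, by rw [gens_natAdd, toEnveloping_D_natAdd]⟩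

theorem extendsHom_leftHom : ExtendsHom (leftHom k n) (toEnveloping k n) where
  exists_gens p := by
    induction p using Fin.addCases with
    | left i => exact ⟨Fin.castAdd _ (Fin.castAdd n i), by
        rw [gens_castAdd, gens_castAdd, toEnveloping_X_castAdd]⟩
    | right i => exact ⟨Fin.natAdd _ (Fin.castAdd n i), by
        rw [gens_natAdd, gens_natAdd, toEnveloping_D_castAdd]⟩
  gens_or_commute q := (toEnveloping_gens k n q).imp_right fun ⟨p, hp⟩ a => by
    rw [hp]
    exact (commute_leftHom_rightHom k n a (gens k p)).symm

theorem extendsHom_rightHom : ExtendsHom (rightHom k n) (toEnveloping k n) where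
  exists_gens p := by
    induction p using Fin.addCases with
    | left i => exact ⟨Fin.castAdd _ (Fin.natAdd n i), by
        rw [gens_castAdd, gens_castAdd, toEnveloping_X_natAdd]⟩
    | right i => exact ⟨Fin.natAdd _ (Fin.natAdd n i), by
        rw [gens_natAdd, gens_natAdd, toEnveloping_D_natAdd]⟩
  gens_or_commute q := (toEnveloping_gens k n q).symm.imp_right fun ⟨p, hp⟩ a => by
    rw [hp]
    exact commute_leftHom_rightHom k n (gens k p) a

section Action

variable (M : Type*) [AddCommGroup M] [Module k M]
  [Module (WeylAlgebra k n) M] [IsScalarTower k (WeylAlgebra k n) M]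
  [Module (WeylAlgebra k n)ᵐᵒᵖ M] [IsScalarTower k (WeylAlgebra k n)ᵐᵒᵖ M]
  [SMulCommClass (WeylAlgebra k n) (WeylAlgebra k n)ᵐᵒᵖ M]

theorem leftHom_smul (a : WeylAlgebra k n) (m : M) :
    letI := envelopingModule k n M
    leftHom k n a • m = a • m := by
  rw [leftHom_apply, TensorProduct.Algebra.smul_def, one_smul]

theorem rightHom_smul (a : WeylAlgebra k n) (m : M) :
    letI := envelopingModule k n M
    rightHom k n a • m = transpose k n a • m := by
  rw [rightHom_apply, TensorProduct.Algebra.smul_def, one_smul]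

theorem envelopingModule_isScalarTower :
    letI := envelopingModule k n M
    IsScalarTower k (WeylAlgebra k n ⊗[k] (WeylAlgebra k n)ᵐᵒᵖ) M := by
  let := envelopingModule k n M
  refine ⟨fun c r m => ?_⟩
  induction r using TensorProduct.induction_on with
  | zero =>
    have h := zero_smul (WeylAlgebra k n ⊗[k] (WeylAlgebra k n)ᵐᵒᵖ) m
    rw [smul_zero, h, smul_zero]
  | tmul a b =>
    rw [TensorProduct.smul_tmul', TensorProduct.Algebra.smul_def, TensorProduct.Algebra.smul_def,
      smul_assoc]
  | add a b ha hb => rw [smul_add, add_smul, add_smul, smul_add, ha, hb]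

end Action

theorem free_of_span_singleton_eq_top {A M : Type*} [Ring A] [AddCommGroup M] [Module A M] {m : M}
    (hm : Submodule.span A {m} = ⊤) (h : Nontrivial M → ∀ a : A, a • m = 0 → a = 0) :
    Module.Free A M := by
  rcases subsingleton_or_nontrivial M with hM | hM
  · exact Module.Free.of_subsingleton A M
  · refine Module.Free.of_equiv (LinearEquiv.ofBijective (LinearMap.toSpanSingleton A M m) ⟨?_, ?_⟩)
    · exact (injective_iff_map_eq_zero _).2 fun a ha => h hM a ha
    · exact fun y => Submodule.mem_span_singleton.1 (hm ▸ Submodule.mem_top)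

end Bimodules

end WeylAlgebra

open WeylAlgebra in
theorem mainTheorem2 (k : Type*) [Field k] [CharZero k] (n : ℕ)
    (M : Type*) [AddCommGroup M] [Module k M]
    [Module (WeylAlgebra k n) M] [IsScalarTower k (WeylAlgebra k n) M]
    [Module (WeylAlgebra k n)ᵐᵒᵖ M] [IsScalarTower k (WeylAlgebra k n)ᵐᵒᵖ M]
    [SMulCommClass (WeylAlgebra k n) (WeylAlgebra k n)ᵐᵒᵖ M] :
    ((Module.Finite (WeylAlgebra k n) M ∨ Module.Finite (WeylAlgebra k n)ᵐᵒᵖ M) →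
      WeylAlgebra.IsHolonomicBimodule k n M) ∧
    ((∃ m : M, Submodule.span (WeylAlgebra k n) {m} = ⊤) →
      Module.Free (WeylAlgebra k n) M ∧
        (Nontrivial M → WeylAlgebra.IsIrreducibleBimodule k n M)) ∧
    ((∃ m : M, Submodule.span (WeylAlgebra k n)ᵐᵒᵖ {m} = ⊤) →
      Module.Free (WeylAlgebra k n)ᵐᵒᵖ M ∧
        (Nontrivial M → WeylAlgebra.IsIrreducibleBimodule k n M)) := by
  let := envelopingModule k n M
  have := envelopingModule_isScalarTower k n M
  refine ⟨?_, ?_, ?_⟩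
  · rintro (h | h)
    · obtain ⟨s, e, he⟩ := Module.Finite.exists_fin (R := WeylAlgebra k n) (M := M)
      refine (extendsHom_leftHom k n).isHolonomic (e := e) fun y => ?_
      obtain ⟨c, hc⟩ := (Submodule.mem_span_range_iff_exists_fun (WeylAlgebra k n)).1
        (show y ∈ Submodule.span (WeylAlgebra k n) (Set.range e) from he ▸ Submodule.mem_top)
      exact ⟨c, by simpa only [leftHom_smul] using hc⟩
    · obtain ⟨s, e, he⟩ := Module.Finite.exists_fin (R := (WeylAlgebra k n)ᵐᵒᵖ) (M := M)
      refine (extendsHom_rightHom k n).isHolonomic (e := e) fun y => ?_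
      obtain ⟨c, hc⟩ := (Submodule.mem_span_range_iff_exists_fun (WeylAlgebra k n)ᵐᵒᵖ).1
        (show y ∈ Submodule.span (WeylAlgebra k n)ᵐᵒᵖ (Set.range e) from he ▸ Submodule.mem_top)
      choose a ha using fun t => transpose_surjective k n (c t)
      exact ⟨a, by simpa only [rightHom_smul, ha] using hc⟩
  · rintro ⟨m, hm⟩
    have hgen : ∀ y : M, ∃ a, leftHom k n a • m = y := by
      intro y
      obtain ⟨a, ha⟩ := Submodule.mem_span_singleton.1
        (show y ∈ Submodule.span (WeylAlgebra k n) {m} from hm ▸ Submodule.mem_top)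
      exact ⟨a, by rw [leftHom_smul, ha]⟩
    refine ⟨free_of_span_singleton_eq_top hm fun _ a ha => ?_, fun _ =>
      (extendsHom_leftHom k n).isSimpleModule hgen⟩
    exact (extendsHom_leftHom k n).eq_zero_of_smul_eq_zero hgen (by rw [leftHom_smul, ha])
  · rintro ⟨m, hm⟩
    have hgen : ∀ y : M, ∃ a, rightHom k n a • m = y := by
      intro y
      obtain ⟨b, hb⟩ := Submodule.mem_span_singleton.1
        (show y ∈ Submodule.span (WeylAlgebra k n)ᵐᵒᵖ {m} from hm ▸ Submodule.mem_top)
      obtain ⟨a, rfl⟩ := transpose_surjective k n b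
      exact ⟨a, by rw [rightHom_smul, hb]⟩
    refine ⟨free_of_span_singleton_eq_top hm fun _ b hb => ?_, fun _ =>
      (extendsHom_rightHom k n).isSimpleModule hgen⟩
    obtain ⟨a, rfl⟩ := transpose_surjective k n b
    rw [(extendsHom_rightHom k n).eq_zero_of_smul_eq_zero hgen (a := a)
      (by rw [rightHom_smul, hb]), map_zero]
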